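/- Let $\mathbb{P}(\mathbb{Z})$ be the set of submodules $\mathbb{Z}(a,b)\subset\mathbb{Z}^2$ generated by unimodular pairs $(a,b)$, and let $G$ be the distant graph on it: two points are adjacent iff the determinant of the matrix of their generators is $\pm1$. Let $\bar x\ne\bar y$ be non-adjacent points, and consider the transition algorithm from $\bar x$ to $\bar y$, with generators $\mathbf x,\mathbf y$ of $\bar x,\bar y$: start with a basis $(\mathbf e_{A_0},\mathbf f_{B_0})$ of $\mathbb{Z}^2$ with $\mathbf e_{A_0}-\mathbf f_{B_0}=\mathbf x$, where $\mathbf e_{A_0}$ lies in the open first and $\mathbf f_{B_0}$ in the open second quadrant with respect to the axes $\mathbf x,\mathbf y$; alternately put $\mathbf e_{A_k}=\mathbf e_{A_{k-1}}+a_k\mathbf f_{B_{k-1}}$ and $\mathbf f_{B_k}=\mathbf f_{B_{k-1}}+b_k\mathbf e_{A_k}$, where $a_k\ge1$ (resp. $b_k\ge1$) is the largest integer for which the new vector is still in the first (resp. second) quadrant; stop when $\mathbf e_{A_r}+\mathbf f_{B_l}=\mathbf y$, where $r\in\{l,l+1\}$. (The names of the two sides and the signs of $\mathbf x,\mathbf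 y$ are chosen so that the side $\mathbf e$ is prolonged first.) Put $a_0=a_{r+1}=b_0=b_{l+1}=1$, let $(c_1,\dots,c_{r+l})=(a_1,b_1,a_2,b_2,\dots)$, let $\bar e_{A_k}$ $(0\le k\le r)$ and $\bar f_{B_k}$ $(0\le k\le l)$ be the corner vertices, i.e. the points generated by $\mathbf e_{A_k}$ and $\mathbf f_{B_k}$, put $\bar e_{A_{r+1}}=\bar f_{B_{l+1}}=\bar y$ and $\bar f_{B_{-1}}=\bar x$, and let the corner graph be the subgraph of $G$ induced on $\bar x,\bar y$ and the corner vertices. Say that *ones split a shortest path* if there are two shortest paths in $G$ from $\bar x$ to $\bar y$ that differ in exactly one vertex, one of them having $u,z,w$ and the other one $u,z',w$ as consecutive vertices, where for some $k$ either * $1\le k\le r$, $a_k=b_k=1$, and $(u,z,z',w)=(\bar e_{A_{k-1}},\bar f_{B_{k-1}},\bar e_{A_k},\bar f_{B_k})$, or * $0\le k\le l$, $b_k=a_{k+1}=1$, and $(u,z,z',w)=(\bar f_{B_{k-1}},\bar f_{B_k},\bar e_{A_k},\bar e_{A_{k+1}})$. Say that *two blocks of 1's overlap* if there are a block (maximal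 interval of indices) $[l_1,l_2]\subset[0,l+1]$ on which $b_{l_1}=\dots=b_{l_2}=1$ and a block (maximal interval of indices) $[r_1,r_2]\subset[0,r+1]$ on which $a_{r_1}=\dots=a_{r_2}=1$ such that one of the following holds: * (o1) $l_1<r_1\le l_2+1\le r_2$, and moreover $l_2<l+1$ in case $r=l+1$; * (o2) $l_1<r_1\le l_2=r_2=r+1=l+1$; * (o3) $0=r_1=l_1\le l_2<r_2$; * (o4) $r_1\le l_1\le r_2\le l_2$, $l_1\ne0$, and moreover $r_2<r+1$ in case $r=l$; * (o5) $r_1\le l_1\le l_2<r_2=r+1=l+2$. Then the following two conditions are each equivalent to the condition that either two blocks of 1's overlap and not all $c_i$ are equal to $1$, or $r=l$ and $c_i=1$ for all $i$ (which is regarded as true if $r=l=0$): 1. ones split a shortest path from $\bar x$ to $\bar y$; 2. there are at least two shortest paths in $G$ from $\bar x$ to $\bar y$ that lie in the corner graph. -/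

import Mathlib

namespace DistantGraph

/-- The projective line over `ℤ`: the cyclic submodules of `ℤ × ℤ` generated by unimodular pairs. -/
def PLine : Type :=
  {M : Submodule ℤ (ℤ × ℤ) // ∃ a b : ℤ, IsCoprime a b ∧ M = Submodule.span ℤ {(a, b)}}

/-- The vector `v` generates the point `x`. -/
def Gen (x : PLine) (v : ℤ × ℤ) : Prop := x.1 = Submodule.span ℤ {v}

/-- The determinant of the matrix with columns `v` and `w`. -/
def det (v w : ℤ × ℤ) : ℤ := v.1 * w.2 - v.2 * w.1

theorem isUnit_det_comm {v w : ℤ × ℤ} (h : IsUnit (det v w)) : IsUnit (det w v) := by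
  have : det w v = - det v w := by unfold det; ring
  rw [this]; exact h.neg

theorem gen_det_self {x : PLine} {v w : ℤ × ℤ} (hv : Gen x v) (hw : Gen x w) : det v w = 0 := by
  have h : v ∈ Submodule.span ℤ {w} := by
    rw [← hw, hv]; exact Submodule.mem_span_singleton_self v
  obtain ⟨c, rfl⟩ := Submodule.mem_span_singleton.1 h
  simp [det]; ring

/-- The distant graph of the projective line over `ℤ`: two points are adjacent when the matrix of
generators is invertible over `ℤ`. -/
def G : SimpleGraph PLine where
  Adj x y := ∃ v w, Gen x v ∧ Gen y w ∧ IsUnit (det v w)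
  symm := ⟨fun _ _ ⟨v, w, hv, hw, h⟩ => ⟨w, v, hw, hv, isUnit_det_comm h⟩⟩
  loopless := ⟨fun _ ⟨_, _, hv, hw, h⟩ => by
    rw [gen_det_self hv hw] at h; exact not_isUnit_zero h⟩

/-- `u` lies in the open cone `{αX + βY : α, β > 0}` (over the rationals). With `X`, `Y` as positive
half-axes, this is the first quadrant; the second quadrant is `InCone (-X) Y`. -/
def InCone (X Y u : ℤ × ℤ) : Prop :=
  ∃ m p q : ℤ, 0 < m ∧ 0 < p ∧ 0 < q ∧ m • u = p • X + q • Y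

/-- A run of the transition algorithm from `x` to `y`, with the names `e`, `f` of the two sides
chosen so that the side `e` is prolonged first. The vectors `E k` and `F k` are the corner vectors
`𝐞_{A_k}` and `𝐟_{B_k}`; the points `e k` and `f k` are the corner vertices `e_{A_k}` and
`f_{B_k}`, with `e (r + 1) = f (l + 1) = y`. -/
structure Transition (x y : PLine) where
  /-- generator of `x` -/
  X : ℤ × ℤ
  /-- generator of `y` -/
  Y : ℤ × ℤ
  /-- number of steps on the side `e` -/
  r : ℕ
  /-- number of steps on the side `f` -/
  l : ℕ
  /-- lengths of the steps on the side `e` -/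
  a : ℕ → ℕ
  /-- lengths of the steps on the side `f` -/
  b : ℕ → ℕ
  /-- corner vectors in the first quadrant -/
  E : ℕ → ℤ × ℤ
  /-- corner vectors in the second quadrant -/
  F : ℕ → ℤ × ℤ
  /-- corner vertices on the side `e` -/
  e : ℕ → PLine
  /-- corner vertices on the side `f` -/
  f : ℕ → PLine
  gen_x : Gen x X
  gen_y : Gen y Y
  -- the initial basis
  basis : IsUnit (det (E 0) (F 0))
  start : E 0 - F 0 = X
  E_zero_mem : InCone X Y (E 0)
  F_zero_mem : InCone (-X) Y (F 0)
  r_eq : r = l ∨ r = l + 1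
  -- add `F k` to `E k` as often as the sum stays in the first quadrant
  a_pos : ∀ k < r, 0 < a (k + 1)
  E_succ : ∀ k < r, E (k + 1) = E k + a (k + 1) • F k
  E_succ_mem : ∀ k < r, InCone X Y (E (k + 1))
  E_succ_max : ∀ k < r, ¬ InCone X Y (E (k + 1) + F k)
  -- add `E (k + 1)` to `F k` as often as the sum stays in the second quadrant
  b_pos : ∀ k < l, 0 < b (k + 1)
  F_succ : ∀ k < l, F (k + 1) = F k + b (k + 1) • E (k + 1)
  F_succ_mem : ∀ k < l, InCone (-X) Y (F (k + 1))
  F_succ_max : ∀ k < l, ¬ InCone (-X) Y (F (k + 1) + E (k + 1))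
  -- the algorithm stops at `Y`
  finish : E r + F l = Y
  -- boundary conventions
  a_zero : a 0 = 1
  a_last : a (r + 1) = 1
  b_zero : b 0 = 1
  b_last : b (l + 1) = 1
  gen_e : ∀ k ≤ r, Gen (e k) (E k)
  gen_f : ∀ k ≤ l, Gen (f k) (F k)
  e_last : e (r + 1) = y
  f_last : f (l + 1) = y

namespace Transition

variable {x y : PLine} (T : Transition x y)

/-- The sequence `(c₁, …, c_{r+l}) = (a₁, b₁, a₂, b₂, …)`. -/
def c (i : ℕ) : ℕ := if i % 2 = 1 then T.a ((i + 1) / 2) else T.b (i / 2)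

/-- All members of `(c₁, …, c_{r+l})` are equal to one. -/
def AllOnes : Prop := ∀ i, 1 ≤ i → i ≤ T.r + T.l → T.c i = 1

/-- Vertices of the corner graph: `x`, `y` and the corner vertices. -/
def IsCornerVertex (u : PLine) : Prop :=
  u = x ∨ u = y ∨ (∃ k ≤ T.r, u = T.e k) ∨ (∃ k ≤ T.l, u = T.f k)

end Transition

/-- A shortest path in the distant graph. -/
def IsShortest {x y : PLine} (p : G.Walk x y) : Prop := p.length = G.dist x y

/-- A shortest path from `x` to `y` runs through `u, z, w` and replacing `z` by the other vertex `z'`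
gives another shortest path from `x` to `y`. -/
def SplitsAt (x y u z z' w : PLine) : Prop :=
  z ≠ z' ∧ ∃ p q : G.Walk x y, IsShortest p ∧ IsShortest q ∧
    ∃ s t : List PLine, p.support = s ++ u :: z :: w :: t ∧ q.support = s ++ u :: z' :: w :: t

namespace Transition

variable {x y : PLine} (T : Transition x y)

/-- Appearance of `1` splits a shortest path: there are two neighbouring ones, `a_k = b_k = 1` or
`b_k = a_{k+1} = 1`, and a shortest path traverses the resulting quadrangle along one pair of its
sides, so that it can also traverse it along the other pair. -/
def SplitsByOne : Prop :=
  (∃ k, 1 ≤ k ∧ k ≤ T.r ∧ T.a k = 1 ∧ T.b k = 1 ∧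
    SplitsAt x y (T.e (k - 1)) (T.f (k - 1)) (T.e k) (T.f k)) ∨
  (∃ k, k ≤ T.l ∧ T.b k = 1 ∧ T.a (k + 1) = 1 ∧
    SplitsAt x y (if k = 0 then x else T.f (k - 1)) (T.f k) (T.e k) (T.e (k + 1)))

/-- There are two different shortest paths from `x` to `y` in the corner graph. -/
def TwoCornerPaths : Prop :=
  ∃ p q : G.Walk x y, p ≠ q ∧ IsShortest p ∧ IsShortest q ∧
    (∀ u ∈ p.support, T.IsCornerVertex u) ∧ (∀ u ∈ q.support, T.IsCornerVertex u)

end Transition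

/-- `s i, …, s j` is a block of ones of the finite sequence `s 0, …, s n`, that is, a maximal
interval of indices on which `s` is equal to one. -/
def IsBlock (s : ℕ → ℕ) (n i j : ℕ) : Prop :=
  i ≤ j ∧ j ≤ n ∧ (∀ k, i ≤ k → k ≤ j → s k = 1) ∧
    (0 < i → s (i - 1) ≠ 1) ∧ (j < n → s (j + 1) ≠ 1)

/-- The five ways in which a block `[l₁, l₂]` of `b` and a block `[r₁, r₂]` of `a` can overlap. -/
def OverlapConfig (r l l₁ l₂ r₁ r₂ : ℕ) : Prop :=
  (l₁ < r₁ ∧ r₁ ≤ l₂ + 1 ∧ l₂ + 1 ≤ r₂ ∧ (r = l + 1 → l₂ < l + 1)) ∨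
  (l₁ < r₁ ∧ r₁ ≤ l₂ ∧ l₂ = r₂ ∧ r₂ = r + 1 ∧ r + 1 = l + 1) ∨
  (r₁ = 0 ∧ l₁ = 0 ∧ l₁ ≤ l₂ ∧ l₂ < r₂) ∨
  (r₁ ≤ l₁ ∧ l₁ ≤ r₂ ∧ r₂ ≤ l₂ ∧ l₁ ≠ 0 ∧ (r = l → r₂ < r + 1)) ∨
  (r₁ ≤ l₁ ∧ l₁ ≤ l₂ ∧ l₂ < r₂ ∧ r₂ = r + 1 ∧ r + 1 = l + 2)

/-- Two blocks of ones, one of `b₀, …, b_{l+1}` and one of `a₀, …, a_{r+1}`, overlap. -/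
def Transition.BlocksOverlap {x y : PLine} (T : Transition x y) : Prop :=
  ∃ l₁ l₂ r₁ r₂, IsBlock T.b (T.l + 1) l₁ l₂ ∧ IsBlock T.a (T.r + 1) r₁ r₂ ∧
    OverlapConfig T.r T.l l₁ l₂ r₁ r₂

end DistantGraph

namespace DistantGraph

theorem inCone_of_det {X Y u : ℤ × ℤ} (h1 : 0 < det u Y * det X Y) (h2 : 0 < det X u * det X Y) :
    InCone X Y u := by
  refine ⟨det X Y ^ 2, det u Y * det X Y, det X u * det X Y, ?_, h1, h2, ?_⟩
  · have : det X Y ≠ 0 := by rintro h; simp [h] at h1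
    positivity
  · ext <;> simp [det] <;> ring

theorem det_pos_of_inCone {X Y u : ℤ × ℤ} (hD : det X Y ≠ 0) (h : InCone X Y u) :
    0 < det u Y * det X Y := by
  obtain ⟨m, p, q, hm, hp, -, h⟩ := h
  have h1 : m * (det u Y * det X Y) = p * det X Y ^ 2 := by
    have e1 := congrArg Prod.fst h
    have e2 := congrArg Prod.snd h
    simp at e1 e2
    simp only [det]
    linear_combination (Y.2 * (X.1 * Y.2 - X.2 * Y.1)) * e1 - (Y.1 * (X.1 * Y.2 - X.2 * Y.1)) * e2
  have h2 : 0 < m * (det u Y * det X Y) := by rw [h1]; positivity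
  exact pos_of_mul_pos_right h2 hm.le

theorem isCoprime_of_det {v w : ℤ × ℤ} (h : IsUnit (det v w)) : IsCoprime v.1 v.2 := by
  rcases Int.isUnit_iff.1 h with h | h <;> unfold det at h
  · exact ⟨w.2, -w.1, by linarith⟩
  · exact ⟨-w.2, w.1, by linarith⟩

/-- The recursive part of the transition algorithm terminates. -/
theorem run_exists (η : ℤ × ℤ →+ ℤ) (Y : ℤ × ℤ) (N : ℕ) :
    ∀ (ξ : ℤ × ℤ →+ ℤ) (α β : ℕ) (E F : ℤ × ℤ), α + β ≤ N → 0 < α → α ≤ β → Nat.Coprime α β →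
    ξ Y = 0 → α • E + β • F = Y → 0 < ξ E → ξ F < 0 → 0 < η E → 0 < η F → IsUnit (det E F) →
    ∃ (r l : ℕ) (a b : ℕ → ℕ) (Es Fs : ℕ → ℤ × ℤ), Es 0 = E ∧ Fs 0 = F ∧ (r = l ∨ r = l + 1) ∧
      (∀ k < r, 0 < a (k + 1) ∧ Es (k + 1) = Es k + a (k + 1) • Fs k ∧ 0 < ξ (Es (k + 1)) ∧
        0 < η (Es (k + 1)) ∧ ξ (Es (k + 1) + Fs k) ≤ 0) ∧
      (∀ k < l, 0 < b (k + 1) ∧ Fs (k + 1) = Fs k + b (k + 1) • Es (k + 1) ∧ ξ (Fs (k + 1)) < 0 ∧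
        0 < η (Fs (k + 1)) ∧ 0 ≤ ξ (Fs (k + 1) + Es (k + 1))) ∧
      Es r + Fs l = Y ∧ (∀ k ≤ r, IsCoprime (Es k).1 (Es k).2) ∧
      (∀ k ≤ l, IsCoprime (Fs k).1 (Fs k).2) := by
  induction N with
  | zero => intro ξ α β E F h h'; omega
  | succ N ih =>
    intro ξ α β E F hN hα hαβ hcop hξY hY hξE hξF hηE hηF hdet
    have cE := isCoprime_of_det hdet
    have cF := isCoprime_of_det (isUnit_det_comm hdet)
    rcases hαβ.eq_or_lt with heq | hlt
    · subst heq
      obtain rfl : α = 1 := by simpa using hcop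
      refine ⟨0, 0, fun _ => 1, fun _ => 1, fun _ => E, fun _ => F, rfl, rfl, Or.inl rfl, ?_, ?_, ?_,
        fun _ _ => cE, fun _ _ => cF⟩
      · intro k hk; omega
      · intro k hk; omega
      · simpa using hY
    · obtain ⟨a, γ, ha, hγ, hγα, hβ⟩ : ∃ a γ : ℕ, 0 < a ∧ 0 < γ ∧ γ ≤ α ∧ β = γ + a * α := by
        refine ⟨(β - 1) / α, (β - 1) % α + 1, Nat.div_pos (by omega) hα, by omega,
          Nat.mod_lt _ hα, ?_⟩
        have := Nat.mod_add_div (β - 1) α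
        rw [mul_comm] at this
        omega
      have hcop' : Nat.Coprime γ α := by
        rw [hβ] at hcop
        simpa [Nat.coprime_add_mul_right_right] using hcop.symm
      have hY' : γ • F + α • (E + a • F) = Y := by
        rw [← hY, hβ, add_smul, mul_comm, mul_smul, smul_add]; abel
      have hdet' : IsUnit (det F (E + a • F)) := by
        have : det F (E + a • F) = det F E := by simp [det]; ring
        rw [this]; exact isUnit_det_comm hdet
      have hx : (γ : ℤ) * ξ F + α * ξ (E + a • F) = 0 := by
        have := congrArg ξ hY'
        rw [map_add, map_nsmul, map_nsmul, hξY] at this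
        simpa using this
      have hξE' : 0 < ξ (E + a • F) := by
        have hα' : (0 : ℤ) < α := by exact_mod_cast hα
        have hγ' : (0 : ℤ) < γ := by exact_mod_cast hγ
        have : 0 < (α : ℤ) * ξ (E + a • F) := by nlinarith
        exact pos_of_mul_pos_right this hα'.le
      have hξs : ξ (E + a • F + F) ≤ 0 := by
        have hα' : (0 : ℤ) < α := by exact_mod_cast hα
        have hγ' : (γ : ℤ) ≤ α := by exact_mod_cast hγα
        have h3 : (α : ℤ) * ξ (E + a • F + F) ≤ 0 := by
          rw [map_add ξ (E + a • F) F]; nlinarith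
        by_contra hc
        push Not at hc
        have := mul_pos hα' hc
        omega
      have hηE' : 0 < η (E + a • F) := by
        rw [map_add, map_nsmul]
        have : (0 : ℤ) < a := by exact_mod_cast ha
        simp only [nsmul_eq_mul]
        nlinarith [mul_pos this hηF]
      have hlt' : γ + α ≤ N := by
        have : α ≤ a * α := Nat.le_mul_of_pos_left _ ha
        omega
      obtain ⟨r, l, b', a', Fs, Es, hF0, hE0, hrl, hb, ha', hend, cFs, cEs⟩ :=
        ih (-ξ) γ α F (E + a • F) hlt' hγ hγα hcop' (by simp [hξY]) hY'
          (by simpa using hξF) (by rw [AddMonoidHom.neg_apply]; omega) hηF hηE' hdet'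
      refine ⟨l + 1, r, fun k => if k = 1 then a else a' (k - 1), b',
        fun k => if k = 0 then E else Es (k - 1), Fs, by simp, hF0, by omega, ?_, ?_, ?_, ?_, ?_⟩
      · intro k hk
        rcases k with _ | k
        · simp only [zero_add, if_true, one_ne_zero, if_false, Nat.sub_self, hE0, hF0]
          exact ⟨ha, trivial, hξE', hηE', hξs⟩
        · obtain ⟨h1, h2, h3, h4, h5⟩ := ha' k (by omega)
          simp only [AddMonoidHom.neg_apply] at h3 h5
          simp
          refine ⟨h1, h2, by linarith, h4, ?_⟩
          rw [map_add] at h5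
          linarith
      · intro k hk
        obtain ⟨h1, h2, h3, h4, h5⟩ := hb k hk
        simp only [AddMonoidHom.neg_apply] at h3 h5
        simp
        refine ⟨h1, h2, by linarith, h4, ?_⟩
        rw [map_add] at h5
        linarith
      · simpa [add_comm] using hend
      · intro k hk
        rcases k with _ | k
        · simpa using cE
        · simpa using cEs k (by omega)
      · intro k hk
        exact cFs k hk

/-- Assembling a run of the transition algorithm from its initial basis. -/
theorem transition_of_basis {x y : PLine} {X Y E F : ℤ × ℤ} (hX : Gen x X) (hY : Gen y Y)
    (hdet : IsUnit (det E F)) (hs : E - F = X) {α β : ℕ} (hα : 0 < α) (hαβ : α ≤ β)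
    (hc : Nat.Coprime α β) (h : α • E + β • F = Y) : Nonempty (Transition x y) := by
  classical
  have hD : det X Y = (α + β) * det E F := by
    rw [← hs, ← h]; simp [det]; ring
  have hu2 : det E F * det E F = 1 := by
    rcases Int.isUnit_iff.1 hdet with h | h <;> rw [h] <;> rfl
  have hα' : (0 : ℤ) < α := by exact_mod_cast hα
  have hβ' : (0 : ℤ) < β := by exact_mod_cast hα.trans_le hαβ
  have hD0 : det X Y ≠ 0 := by
    rw [hD]; exact mul_ne_zero (by positivity) hdet.ne_zero
  let ξ : ℤ × ℤ →+ ℤ := AddMonoidHom.mk' (fun u => det u Y * det X Y) (by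
    intro u v; simp [det]; ring)
  let η : ℤ × ℤ →+ ℤ := AddMonoidHom.mk' (fun u => det X u * det X Y) (by
    intro u v; simp [det]; ring)
  have hξ : ∀ u, ξ u = det u Y * det X Y := fun _ => rfl
  have hη : ∀ u, η u = det X u * det X Y := fun _ => rfl
  have q1 : ∀ u, 0 < ξ u → 0 < η u → InCone X Y u := fun u h1 h2 => inCone_of_det h1 h2
  have hneg : det (-X) Y = - det X Y := by simp [det]; ring
  have hneg' : ∀ u, det (-X) u = - det X u := by intro u; simp [det]; ring
  have q2 : ∀ u, ξ u < 0 → 0 < η u → InCone (-X) Y u := fun u h1 h2 => by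
    rw [hξ] at h1
    rw [hη] at h2
    apply inCone_of_det
    · rw [hneg]; linarith
    · rw [hneg, hneg']; linarith
  have n1 : ∀ u, ξ u ≤ 0 → ¬ InCone X Y u := fun u h1 h2 => by
    have := det_pos_of_inCone hD0 h2
    rw [hξ] at h1; omega
  have n2 : ∀ u, 0 ≤ ξ u → ¬ InCone (-X) Y u := fun u h1 h2 => by
    have := det_pos_of_inCone (by rw [hneg]; exact neg_ne_zero.2 hD0) h2
    rw [hξ] at h1; rw [hneg] at this; linarith
  have e1 : det E Y = β * det E F := by rw [← h]; simp [det]; ring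
  have e2 : det F Y = -(α * det E F) := by rw [← h]; simp [det]; ring
  have e3 : det X E = det E F := by rw [← hs]; simp [det]; ring
  have e4 : det X F = det E F := by rw [← hs]; simp [det]; ring
  have hξE : 0 < ξ E := by
    have : ξ E = β * (α + β) * (det E F * det E F) := by rw [hξ, e1, hD]; ring
    rw [this, hu2]; positivity
  have hξF : ξ F < 0 := by
    have : ξ F = -(α * (α + β) * (det E F * det E F)) := by rw [hξ, e2, hD]; ring
    rw [this, hu2, neg_lt_zero]; positivity
  have hηE : 0 < η E := by
    have : η E = (α + β) * (det E F * det E F) := by rw [hη, e3, hD]; ring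
    rw [this, hu2]; positivity
  have hηF : 0 < η F := by
    have : η F = (α + β) * (det E F * det E F) := by rw [hη, e4, hD]; ring
    rw [this, hu2]; positivity
  obtain ⟨r, l, a, b, Es, Fs, hE0, hF0, hrl, ha, hb, hend, cE, cF⟩ :=
    run_exists η Y (α + β) ξ α β E F le_rfl hα hαβ hc (by rw [hξ, show det Y Y = 0 by unfold det; ring, zero_mul]) h
      hξE hξF hηE hηF hdet
  let pt : ℤ × ℤ → PLine := fun v =>
    if hv : IsCoprime v.1 v.2 then ⟨Submodule.span ℤ {v}, v.1, v.2, hv, rfl⟩ else y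
  have hpt : ∀ v : ℤ × ℤ, IsCoprime v.1 v.2 → Gen (pt v) v := by
    intro v hv; simp [pt, hv, Gen]
  exact ⟨{
    X := X, Y := Y, r := r, l := l
    a := fun k => if k = 0 ∨ k = r + 1 then 1 else a k
    b := fun k => if k = 0 ∨ k = l + 1 then 1 else b k
    E := Es, F := Fs
    e := fun k => if k = r + 1 then y else pt (Es k)
    f := fun k => if k = l + 1 then y else pt (Fs k)
    gen_x := hX, gen_y := hY
    basis := by rw [hE0, hF0]; exact hdet
    start := by rw [hE0, hF0]; exact hs
    E_zero_mem := by rw [hE0]; exact q1 _ hξE hηE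
    F_zero_mem := by rw [hF0]; exact q2 _ hξF hηF
    r_eq := hrl
    a_pos := fun k hk => by
      rw [if_neg (by omega)]; exact (ha k hk).1
    E_succ := fun k hk => by
      rw [if_neg (by omega)]; exact (ha k hk).2.1
    E_succ_mem := fun k hk => q1 _ (ha k hk).2.2.1 (ha k hk).2.2.2.1
    E_succ_max := fun k hk => n1 _ (ha k hk).2.2.2.2
    b_pos := fun k hk => by
      rw [if_neg (by omega)]; exact (hb k hk).1
    F_succ := fun k hk => by
      rw [if_neg (by omega)]; exact (hb k hk).2.1
    F_succ_mem := fun k hk => q2 _ (hb k hk).2.2.1 (hb k hk).2.2.2.1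
    F_succ_max := fun k hk => n2 _ (hb k hk).2.2.2.2
    finish := hend
    a_zero := by simp
    a_last := by simp
    b_zero := by simp
    b_last := by simp
    gen_e := fun k hk => by
      rw [if_neg (by omega)]; exact hpt _ (cE k hk)
    gen_f := fun k hk => by
      rw [if_neg (by omega)]; exact hpt _ (cF k hk)
    e_last := by simp
    f_last := by simp }⟩

/-- The transition algorithm can be run, and stops, for any two distinct non-adjacent points. -/
theorem Transition.nonempty {x y : PLine} (hxy : x ≠ y) (hadj : ¬ G.Adj x y) :
    Nonempty (Transition x y) := by
  obtain ⟨x1, x2, ⟨s, t, hst⟩, hX⟩ := x.2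
  obtain ⟨y1, y2, hy, hY⟩ := y.2
  have hX : Gen x (x1, x2) := hX
  have hY : Gen y (y1, y2) := hY
  -- coordinates of the generator of `y` in the basis formed by `(x1, x2)` and `(-t, s)`
  obtain ⟨Y, p, q, hY, hq, hpq, hYe⟩ : ∃ (Y : ℤ × ℤ) (p q : ℤ), Gen y Y ∧ 0 ≤ q ∧ IsCoprime p q ∧
      Y = p • (x1, x2) + q • (-t, s) := by
    have key : IsCoprime (s * y1 + t * y2) (x1 * y2 - x2 * y1) := by
      obtain ⟨m, n, hmn⟩ := hy
      refine ⟨m * x1 + n * x2, -m * t + n * s, ?_⟩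
      linear_combination hmn + (m * y1 + n * y2) * hst
    have hy1 : (y1, y2) = (s * y1 + t * y2) • (x1, x2) + (x1 * y2 - x2 * y1) • (-t, s) := by
      ext <;> simp
      · linear_combination (-y1) * hst
      · linear_combination (-y2) * hst
    rcases le_total 0 (x1 * y2 - x2 * y1) with h | h
    · exact ⟨(y1, y2), _, _, hY, h, key, hy1⟩
    · refine ⟨-(y1, y2), _, _, ?_, neg_nonneg.2 h, key.neg_neg, ?_⟩
      · unfold Gen at hY ⊢
        rw [hY, ← Set.neg_singleton, Submodule.span_neg]
      · rw [neg_smul, neg_smul, ← neg_add, ← hy1]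
  have hdetY : det (x1, x2) Y = q := by
    rw [hYe]; simp [det]; linear_combination q * hst
  have hq0 : q ≠ 0 := by
    rintro rfl
    apply hxy
    have hp : IsUnit p := isCoprime_zero_right.1 hpq
    apply Subtype.ext
    have h1 : x.1 = _ := hX
    have h2 : y.1 = _ := hY
    rw [h1, h2, hYe]
    rcases Int.isUnit_iff.1 hp with rfl | rfl
    · simp
    · rw [zero_smul, add_zero, neg_smul, one_smul, ← Set.neg_singleton, Submodule.span_neg]
  have hq1 : q ≠ 1 := by
    rintro rfl
    exact hadj ⟨_, _, hX, hY, by rw [hdetY]; exact isUnit_one⟩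
  have hqpos : 0 < q := by omega
  have hα0 : 0 ≤ p % q := Int.emod_nonneg _ hq0
  have hαq : p % q < q := Int.emod_lt_of_pos _ hqpos
  have hpn : p % q + q * (p / q) = p := Int.emod_add_mul_ediv p q
  have hcop : IsCoprime (p % q) q := by
    rw [← hpn] at hpq
    exact (IsCoprime.add_mul_left_left_iff).1 hpq
  have hα1 : p % q ≠ 0 := by
    intro h
    rw [h, isCoprime_zero_left, Int.isUnit_iff] at hcop
    omega
  obtain ⟨α, hα⟩ := Int.eq_ofNat_of_zero_le hα0
  obtain ⟨β, hβ⟩ := Int.eq_ofNat_of_zero_le (show 0 ≤ q - p % q by omega)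
  have hqe : q = α + β := by omega
  have hc : Nat.Coprime α β := by
    rw [hα, hqe] at hcop
    have h2 : IsCoprime (α : ℤ) (β : ℤ) := by
      obtain ⟨m, n, h⟩ := hcop
      exact ⟨m + n, n, by linear_combination h⟩
    exact Nat.isCoprime_iff_coprime.1 h2
  set n := p / q with hn
  have hp : p = α + (α + β) * n := by rw [← hpn, hα, hqe]
  have hsum : α • ((-t, s) + (n + 1) • (x1, x2)) + β • ((-t, s) + n • (x1, x2)) = Y := by
    rw [hYe, hp, hqe]
    ext <;> simp <;> ring
  rcases le_total α β with hle | hle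
  · refine transition_of_basis hX hY (E := (-t, s) + (n + 1) • (x1, x2))
      (F := (-t, s) + n • (x1, x2)) ?_ ?_ (α := α) (β := β) (by omega) hle hc hsum
    · have : det ((-t, s) + (n + 1) • (x1, x2)) ((-t, s) + n • (x1, x2)) = 1 := by
        simp [det]; linear_combination hst
      rw [this]; exact isUnit_one
    · ext <;> simp <;> ring
  · have hX' : Gen x (-(x1, x2)) := by
      unfold Gen at hX ⊢
      rw [hX, ← Set.neg_singleton, Submodule.span_neg]
    refine transition_of_basis hX' hY (F := (-t, s) + (n + 1) • (x1, x2))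
      (E := (-t, s) + n • (x1, x2)) ?_ ?_ (α := β) (β := α) (by omega) hle hc.symm
      (by rw [add_comm]; exact hsum)
    · have : det ((-t, s) + n • (x1, x2)) ((-t, s) + (n + 1) • (x1, x2)) = -1 := by
        simp [det]; linear_combination (-1) * hst
      rw [this]; exact isUnit_one.neg
    · ext <;> simp <;> ring

end DistantGraph

/-!
The vectors `-𝐱, 𝐞₀, 𝐟₀, 𝐞₁, 𝐟₁, …, 𝐲` form one sequence `W` with
`W (i + 2) = W i + c i • W (i + 1)`, where `c` is the sequence `b₀, a₁, b₁, a₂, …`. The points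
`P i` that they generate are the corners of the strip of triangles between `x` and `y` (`Strip`,
`Transition.strip`): `P i` is adjacent to `P (i + 1)`, and to `P (i + 2)` if and only if
`c i = 1`. In the graph with these edges the distance `lev c i` from `0` to `i` has a simple
recursion.

*The strip is isometrically embedded* (`Strip.side_lt_zero`, `Strip.dist_eq_lev`). Every edge
separates the distant graph, the side of a point being the sign of the product of its two coordinates
(`side`), and if two edges of the strip are disjoint, then points on the earlier edge or behind it
lie strictly behind the later one. So a walk needs at least one step from each such edge to the next
one. A chain of such edges of the right length is found by induction; where the levels increase at
three consecutive corners, it has to contain an edge inside the fan around the middle one.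

*Both conditions amount to a split* (`Transition.splitsByOne_iff`, `Transition.twoCornerPaths_iff`),
that is, to an index `i` with `c i = c (i + 1) = 1` such that a shortest path visits `P i` and
`P (i + 3)` and may visit either of `P (i + 1)`, `P (i + 2)` in between. At most two corners, and
then consecutive ones, have the same distance from `x`. Hence where two shortest paths in the corner
graph diverge, they go from some `P i` to `P (i + 1)` and `P (i + 2)`, and the first of them has to go
on to `P (i + 3)`.

*A split exists if and only if some maximal run of ones in `c` has even length* (`exists_split_iff`).
Steps of length two are possible only at ones, and inside a run of length `k` at most `⌈k/2⌉` of them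
fit. In an odd run there is only one way to place that many, in an even run there are several. The
levels see this: along a run they increase at every other index (`lev_succ_eq_iff_odd`).

*Even runs are overlapping blocks* (`Interlaced.exists_evenRun_iff`). A run of even length begins and
ends in different ones of the sequences `a` and `b`, or at the boundary, and the cases for its two
ends are the five configurations of overlapping blocks. If all terms are ones, then the only run has
length `r + l + 2`, which is even if and only if `r = l`.
-/

namespace DistantGraph

/-! ### Generators and adjacency -/

theorem Gen.eq_or_eq_neg {z : PLine} {u v : ℤ × ℤ} (hu : Gen z u) (hv : Gen z v) :
    u = v ∨ u = -v := by
  obtain ⟨ε, hε⟩ := Submodule.span_singleton_eq_span_singleton.1 (hv.symm.trans hu)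
  rcases Int.units_eq_one_or ε with rfl | rfl
  · exact Or.inl (by simpa using hε.symm)
  · exact Or.inr (by simpa using hε.symm)

theorem adj_of_isUnit {z z' : PLine} {u v : ℤ × ℤ} (hu : Gen z u) (hv : Gen z' v)
    (h : IsUnit (det u v)) : G.Adj z z' := ⟨u, v, hu, hv, h⟩

theorem isUnit_of_adj {z z' : PLine} {u v : ℤ × ℤ} (hu : Gen z u) (hv : Gen z' v)
    (h : G.Adj z z') : IsUnit (det u v) := by
  obtain ⟨u', v', hu', hv', h⟩ := h
  rw [Int.isUnit_iff] at *
  rcases hu.eq_or_eq_neg hu' with rfl | rfl <;> rcases hv.eq_or_eq_neg hv' with rfl | rfl <;>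
    simp [det] at * <;> omega

theorem Gen.eq {z z' : PLine} {u : ℤ × ℤ} (h : Gen z u) (h' : Gen z' u) : z = z' :=
  Subtype.ext (h.trans h'.symm)

theorem Gen.neg {z : PLine} {u : ℤ × ℤ} (h : Gen z u) : Gen z (-u) := by
  unfold Gen at h ⊢
  rw [h, ← Set.neg_singleton, Submodule.span_neg]

theorem Gen.exists (z : PLine) : ∃ u, Gen z u ∧ IsCoprime u.1 u.2 :=
  let ⟨a, b, h, e⟩ := z.2
  ⟨(a, b), e, h⟩

theorem Gen.isCoprime {z : PLine} {u : ℤ × ℤ} (h : Gen z u) : IsCoprime u.1 u.2 := by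
  obtain ⟨v, hv, hc⟩ := Gen.exists z
  rcases h.eq_or_eq_neg hv with rfl | rfl
  · exact hc
  · exact hc.neg_neg

/-! ### The side of an edge -/

/-- The product of the two coordinates of `u` with respect to the basis `A`, `B` of `ℤ × ℤ`. It
vanishes at the two ends of the edge spanned by `A` and `B`, and its sign tells on which side of
that edge the point generated by `u` lies. -/
def side (A B u : ℤ × ℤ) : ℤ := det u B * det A u

theorem side_neg (A B u : ℤ × ℤ) : side A B (-u) = side A B u := by
  simp [side, det]; ring

/-- An edge separates the graph: a neighbour of a point strictly on one side is not strictly on the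
other side. -/
theorem side_nonpos_of_isUnit {A B u v : ℤ × ℤ} (hAB : IsUnit (det A B)) (huv : IsUnit (det u v))
    (hu : side A B u < 0) : side A B v ≤ 0 := by
  have key : det u v * det A B = det u B * det A v - det v B * det A u := by
    simp [det]; ring
  have hunit := huv.mul hAB
  rw [key, Int.isUnit_iff] at hunit
  unfold side at *
  generalize det u B = p at *
  generalize det A u = q at *
  generalize det v B = p' at *
  generalize det A v = q' at *
  by_contra! h
  have h1 : (p * q') * (p' * q) < 0 := by nlinarith
  rcases lt_trichotomy (p * q') 0 with h2 | h2 | h2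
  · have : 0 < p' * q := by nlinarith
    omega
  · simp [h2] at h1
  · have : p' * q < 0 := by nlinarith
    omega

/-- If both coordinates of `A'` and `B'` in the basis `A`, `B` are positive, then the edge `A'`,
`B'` is disjoint from the edge `A`, `B`, and the latter lies strictly on the negative side. -/
theorem side_lt_zero_of_pos {A B A' B' u : ℤ × ℤ} {α β γ δ : ℤ} (hα : 0 < α) (hβ : 0 < β)
    (hγ : 0 < γ) (hδ : 0 < δ) (hA : A' = α • A + β • B) (hB : B' = γ • A + δ • B)
    (hAB : IsUnit (det A B)) (hu0 : IsCoprime u.1 u.2) (hu : side A B u ≤ 0) :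
    side A' B' u < 0 := by
  have hne : det u B ≠ 0 ∨ det A u ≠ 0 := by
    by_contra! h
    have e1 : u.1 * det A B = 0 := by
      linear_combination (exp := 1) A.1 * h.1 + B.1 * h.2 + (by simp [det]; ring : u.1 * det A B =
        A.1 * det u B + B.1 * det A u)
    have e2 : u.2 * det A B = 0 := by
      linear_combination (exp := 1) A.2 * h.1 + B.2 * h.2 + (by simp [det]; ring : u.2 * det A B =
        A.2 * det u B + B.2 * det A u)
    have f1 := (mul_eq_zero.1 e1).resolve_right hAB.ne_zero
    have f2 := (mul_eq_zero.1 e2).resolve_right hAB.ne_zero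
    rw [f1, f2] at hu0
    exact not_isCoprime_zero_zero hu0
  have e : side A' B' u = side A B u * (α * δ + β * γ) - β * δ * det u B ^ 2 -
      α * γ * det A u ^ 2 := by
    subst hA hB; simp [side, det]; ring
  rw [e]
  have h1 : side A B u * (α * δ + β * γ) ≤ 0 :=
    mul_nonpos_of_nonpos_of_nonneg hu (by positivity)
  have h2 : 0 ≤ β * δ * det u B ^ 2 := by positivity
  have h3 : 0 ≤ α * γ * det A u ^ 2 := by positivity
  rcases hne with h | h
  · have : 0 < β * δ * det u B ^ 2 := by positivity
    linarith
  · have : 0 < α * γ * det A u ^ 2 := by positivity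
    linarith

/-! ### Levels of a sequence -/

/-- The number of steps that it takes to get from `0` to `k` when the steps `i → i + 1` are always
allowed and the steps `i → i + 2` are allowed if `c i = 1`. -/
def lev (c : ℕ → ℕ) : ℕ → ℕ
  | 0 => 0
  | 1 => 1
  | k + 2 => (if c k = 1 then lev c k else lev c (k + 1)) + 1

theorem lev_add_two_of_one {c : ℕ → ℕ} {k : ℕ} (h : c k = 1) : lev c (k + 2) = lev c k + 1 := by
  simp [lev, h]

theorem lev_add_two_of_ne {c : ℕ → ℕ} {k : ℕ} (h : c k ≠ 1) :
    lev c (k + 2) = lev c (k + 1) + 1 := by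
  simp [lev, h]

theorem lev_succ_bounds (c : ℕ → ℕ) (k : ℕ) :
    lev c k ≤ lev c (k + 1) ∧ lev c (k + 1) ≤ lev c k + 1 := by
  induction k with
  | zero => simp [lev]
  | succ k ih =>
    by_cases h : c k = 1
    · rw [lev_add_two_of_one h]; omega
    · rw [lev_add_two_of_ne h]; omega

theorem lev_mono (c : ℕ → ℕ) : Monotone (lev c) :=
  monotone_nat_of_le_succ fun k => (lev_succ_bounds c k).1

theorem lev_lt_lev_add_two (c : ℕ → ℕ) (k : ℕ) : lev c k < lev c (k + 2) := by
  have := lev_succ_bounds c k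
  by_cases h : c k = 1
  · rw [lev_add_two_of_one h]; omega
  · rw [lev_add_two_of_ne h]; omega

theorem lev_succ_pos (c : ℕ → ℕ) (k : ℕ) : 0 < lev c (k + 1) :=
  lt_of_lt_of_le (by simp [lev]) (lev_mono c (show 1 ≤ k + 1 by omega))

theorem two_le_lev_add_three (c : ℕ → ℕ) (k : ℕ) : 2 ≤ lev c (k + 3) := by
  have h1 : lev c (k + 1) < lev c (k + 3) := lev_lt_lev_add_two c (k + 1)
  have h2 := lev_succ_pos c k
  omega

/-! ### Strips of triangles -/

/-- A strip of triangles of the distant graph, given by its corners: a sequence of vectors with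
`W (i + 2) = W i + c i • W (i + 1)`, whose first two members form a basis of `ℤ × ℤ`, and the points
that they generate. Consecutive points are adjacent, and `P i` and `P (i + 2)` are the ends of a fan
of `c i` triangles with centre `P (i + 1)`. The sequence is infinite, so that every edge of a finite
part of the strip has a successor. -/
structure Strip where
  /-- sizes of the fans -/
  c : ℕ → ℕ
  /-- corner vectors -/
  W : ℕ → ℤ × ℤ
  /-- corner points -/
  P : ℕ → PLine
  c_pos : ∀ i, 0 < c i
  unit : IsUnit (det (W 0) (W 1))
  W_add_two : ∀ i, W (i + 2) = W i + (c i : ℤ) • W (i + 1)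
  gen : ∀ i, Gen (P i) (W i)

namespace Strip

variable (S : Strip)

theorem isUnit_det (i : ℕ) : IsUnit (det (S.W i) (S.W (i + 1))) := by
  induction i with
  | zero => exact S.unit
  | succ i ih =>
    have : det (S.W (i + 1)) (S.W (i + 1 + 1)) = - det (S.W i) (S.W (i + 1)) := by
      rw [S.W_add_two i]; simp [det]; ring
    rw [this]; exact ih.neg

/-- The strip without its first `j` points. -/
def shift (j : ℕ) : Strip where
  c i := S.c (j + i)
  W i := S.W (j + i)
  P i := S.P (j + i)
  c_pos _ := S.c_pos _
  unit := S.isUnit_det j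
  W_add_two i := S.W_add_two (j + i)
  gen i := S.gen (j + i)

theorem adj_succ (i : ℕ) : G.Adj (S.P i) (S.P (i + 1)) :=
  adj_of_isUnit (S.gen i) (S.gen (i + 1)) (S.isUnit_det i)

theorem adj_add_two {i : ℕ} (h : S.c i = 1) : G.Adj (S.P i) (S.P (i + 2)) := by
  refine adj_of_isUnit (S.gen i) (S.gen (i + 2)) ?_
  have : det (S.W i) (S.W (i + 2)) = det (S.W i) (S.W (i + 1)) := by
    rw [S.W_add_two i, h]; simp [det]; ring
  rw [this]; exact S.isUnit_det i

/-- `S.Ball m z` says that `z` is at distance at most `m` from the first point of the strip. -/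
def Ball (m : ℕ) (z : PLine) : Prop := ∃ p : G.Walk (S.P 0) z, p.length ≤ m

variable {S}

theorem Ball.mono {m m' : ℕ} {z : PLine} (h : S.Ball m z) (hm : m ≤ m') : S.Ball m' z :=
  let ⟨p, hp⟩ := h
  ⟨p, hp.trans hm⟩

theorem Ball.zero {z : PLine} (h : S.Ball 0 z) : z = S.P 0 := by
  obtain ⟨p, hp⟩ := h
  exact (SimpleGraph.Walk.eq_of_length_eq_zero (Nat.le_zero.1 hp)).symm

theorem Ball.succ {m : ℕ} {z : PLine} (h : S.Ball (m + 1) z) :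
    S.Ball m z ∨ ∃ z', S.Ball m z' ∧ G.Adj z' z := by
  obtain ⟨p, hp⟩ := h
  rcases Nat.eq_zero_or_pos p.length with h0 | h0
  · exact Or.inl ⟨p, by omega⟩
  · have hn : ¬ p.Nil := fun h => h0.ne' (SimpleGraph.Walk.length_eq_zero_iff.2 h)
    exact Or.inr ⟨p.penultimate, ⟨p.dropLast, by
      rw [SimpleGraph.Walk.length_dropLast]; omega⟩, p.adj_penultimate hn⟩

/-- If the ball of radius `m` lies strictly behind an edge, then the edge can be reached, but not
surpassed, in one more step. -/
theorem Ball.side_nonpos {A B : ℤ × ℤ} (hAB : IsUnit (det A B)) {m : ℕ}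
    (h : ∀ z, S.Ball m z → ∀ u, Gen z u → side A B u < 0) {z : PLine} (hz : S.Ball (m + 1) z)
    {u : ℤ × ℤ} (hu : Gen z u) : side A B u ≤ 0 := by
  rcases hz.succ with hz | ⟨z', hz', hadj⟩
  · exact (h z hz u hu).le
  · obtain ⟨v, hv, -⟩ := Gen.exists z'
    exact side_nonpos_of_isUnit hAB (isUnit_of_adj hv hu hadj) (h z' hz' v hv)

variable (S)

/-- The points at distance less than `lev S.c i` from the first point of the strip lie strictly
behind the edge from `S.P i` to `S.P (i + 1)`. -/
theorem side_lt_zero (i : ℕ) : ∀ m < lev S.c i, ∀ z, S.Ball m z → ∀ u, Gen z u →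
    side (S.W i) (S.W (i + 1)) u < 0 := by
  induction i using Nat.strong_induction_on with
  | _ i ih =>
  have weak : ∀ j < i, ∀ m ≤ lev S.c j, ∀ z, S.Ball m z → ∀ u, Gen z u →
      side (S.W j) (S.W (j + 1)) u ≤ 0 := by
    intro j hj m hm z hz u hu
    rcases j with _ | j
    · rw [Nat.le_zero.1 hm] at hz
      rw [hz.zero] at hu
      simp [side, gen_det_self (S.gen 0) hu]
    · rcases m with _ | m
      · exact (ih (j + 1) hj 0 (lev_succ_pos _ _) z hz u hu).le
      · exact Ball.side_nonpos (S.isUnit_det _) (ih (j + 1) hj m (by omega)) hz hu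
  intro m hm z hz u hu
  have huc := Gen.isCoprime hu
  rcases i with _ | _ | i
  · simp [lev] at hm
  · obtain rfl : m = 0 := by simpa [lev] using hm
    rw [hz.zero] at hu
    have hc : (0 : ℤ) < S.c 0 := by exact_mod_cast S.c_pos 0
    have e : side (S.W 1) (S.W 2) (S.W 0) = -(S.c 0 * (det (S.W 0) (S.W 1)) ^ 2) := by
      rw [S.W_add_two 0]; simp [side, det]; ring
    have hd : 0 < (det (S.W 0) (S.W 1)) ^ 2 := by
      have := S.unit.ne_zero
      positivity
    have : side (S.W 1) (S.W 2) (S.W 0) < 0 := by rw [e]; nlinarith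
    rcases hu.eq_or_eq_neg (S.gen 0) with rfl | rfl
    · exact this
    · rw [side_neg]; exact this
  · have hc : (0 : ℤ) < S.c i := by exact_mod_cast S.c_pos i
    have hc' : (0 : ℤ) < S.c (i + 1) := by exact_mod_cast S.c_pos (i + 1)
    have hW := S.W_add_two i
    have hW' := S.W_add_two (i + 1)
    rw [hW] at hW'
    by_cases h1 : S.c i = 1
    · rw [lev_add_two_of_one h1] at hm
      refine side_lt_zero_of_pos hc one_pos hc' (δ := 1 + S.c (i + 1)) (by omega) ?_ ?_
        (S.isUnit_det i) huc (weak i (by omega) m (by omega) z hz u hu)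
      · rw [hW, h1]; simp
      · rw [hW', h1]; ext <;> simp <;> ring
    · -- the edge from `W i + W (i + 1)` to `W (i + 1)`, which lies in the fan around `W (i + 1)`,
      -- cannot be reached before `W (i + 1)` itself
      rw [lev_add_two_of_ne h1] at hm
      have hc2 : (2 : ℤ) ≤ S.c i := by
        have := S.c_pos i
        exact_mod_cast (show 2 ≤ S.c i by omega)
      have hdet : IsUnit (det (S.W i + S.W (i + 1)) (S.W (i + 1))) := by
        have : det (S.W i + S.W (i + 1)) (S.W (i + 1)) = det (S.W i) (S.W (i + 1)) := by
          simp [det]; ring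
        rw [this]; exact S.isUnit_det i
      obtain ⟨n, hn⟩ : ∃ n, lev S.c (i + 1) = n + 1 :=
        Nat.exists_eq_succ_of_ne_zero (lev_succ_pos S.c i).ne'
      have hlev := lev_succ_bounds S.c i
      have strict : ∀ z, S.Ball n z → ∀ u, Gen z u →
          side (S.W i + S.W (i + 1)) (S.W (i + 1)) u < 0 := by
        intro z hz u hu
        have s1 := weak i (by omega) n (by omega) z hz u hu
        have s2 := ih (i + 1) (by omega) n (by omega) z hz u hu
        have hp : det u (S.W (i + 1)) ≠ 0 := by
          intro h
          have h' : det (S.W (i + 1)) u = 0 := by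
            rw [← neg_eq_zero, ← h]; simp [det]; ring
          simp [side, h'] at s2
        have e : side (S.W i + S.W (i + 1)) (S.W (i + 1)) u =
            side (S.W i) (S.W (i + 1)) u - det u (S.W (i + 1)) ^ 2 := by
          simp [side, det]; ring
        have : 0 < det u (S.W (i + 1)) ^ 2 := by positivity
        omega
      refine side_lt_zero_of_pos (α := 1) (β := S.c i - 1) (γ := S.c (i + 1))
        (δ := 1 + S.c (i + 1) * (S.c i - 1)) one_pos (by omega) hc' ?_ ?_ ?_ hdet huc
        (Ball.side_nonpos hdet strict (hz.mono (by omega)) hu)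
      · have : 0 ≤ (S.c (i + 1) : ℤ) * (S.c i - 1) := mul_nonneg hc'.le (by omega)
        omega
      · rw [hW]; ext <;> simp <;> ring
      · rw [hW']; ext <;> simp <;> ring

theorem lev_le_length {k : ℕ} (p : G.Walk (S.P 0) (S.P k)) : lev S.c k ≤ p.length := by
  by_contra! h
  have := S.side_lt_zero k _ h _ ⟨p, le_rfl⟩ _ (S.gen k)
  have e : side (S.W k) (S.W (k + 1)) (S.W k) = 0 := by
    simp [side, gen_det_self (S.gen k) (S.gen k)]
  omega

/-- The points of a strip are connected by walks inside the strip whose lengths are given by the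
levels. -/
theorem exists_walk (k : ℕ) : ∃ p : G.Walk (S.P 0) (S.P k), p.length = lev S.c k ∧
    ∀ z ∈ p.support, ∃ m ≤ k, z = S.P m := by
  induction k using Nat.strong_induction_on with
  | _ k ih =>
  have ext : ∀ j < k, G.Adj (S.P j) (S.P k) → ∃ p : G.Walk (S.P 0) (S.P k),
      p.length = lev S.c j + 1 ∧ ∀ z ∈ p.support, ∃ m ≤ k, z = S.P m := by
    intro j hj hadj
    obtain ⟨p, hp, hs⟩ := ih j hj
    refine ⟨p.concat hadj, by simp [hp], ?_⟩
    intro z hz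
    rw [SimpleGraph.Walk.support_concat, List.mem_append] at hz
    rcases hz with hz | hz
    · obtain ⟨m, hm, rfl⟩ := hs z hz
      exact ⟨m, by omega, rfl⟩
    · exact ⟨k, le_rfl, by simpa using hz⟩
  rcases k with _ | _ | k
  · exact ⟨.nil, rfl, fun z hz => ⟨0, le_rfl, by simpa using hz⟩⟩
  · exact ext 0 (by omega) (S.adj_succ 0)
  · by_cases h : S.c k = 1
    · rw [lev_add_two_of_one h]
      exact ext k (by omega) (S.adj_add_two h)
    · rw [lev_add_two_of_ne h]
      exact ext (k + 1) (by omega) (S.adj_succ _)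

theorem dist_eq_lev (k : ℕ) : G.dist (S.P 0) (S.P k) = lev S.c k := by
  obtain ⟨p, hp, -⟩ := S.exists_walk k
  refine le_antisymm (hp ▸ SimpleGraph.dist_le p) ?_
  obtain ⟨q, hq⟩ := p.reachable.exists_walk_length_eq_dist
  rw [← hq]; exact S.lev_le_length q

/-- Points of a strip are adjacent only if they are the ends of a trivial fan or consecutive. -/
theorem of_adj {i j : ℕ} (hij : i < j) (h : G.Adj (S.P i) (S.P j)) :
    j = i + 1 ∨ (j = i + 2 ∧ S.c i = 1) := by
  obtain ⟨k, rfl⟩ : ∃ k, j = i + k := ⟨j - i, by omega⟩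
  have hl : lev (S.shift i).c k ≤ 1 :=
    (S.shift i).lev_le_length (k := k) (SimpleGraph.Walk.cons (v := S.P (i + k)) h .nil)
  rcases k with _ | _ | _ | k
  · omega
  · exact Or.inl rfl
  · refine Or.inr ⟨rfl, ?_⟩
    by_contra hc
    rw [lev_add_two_of_ne (by exact hc)] at hl
    simp [lev] at hl
  · exact absurd hl (not_le.2 (two_le_lev_add_three (S.shift i).c k))

end Strip

/-! ### Indices on shortest paths -/

theorem lev_add_le (c : ℕ → ℕ) (j k : ℕ) :
    lev c (j + k) ≤ lev c j + lev (fun i => c (j + i)) k := by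
  induction k using Nat.strong_induction_on with
  | _ k ih =>
  rcases k with _ | _ | k
  · simp [lev]
  · simpa [lev] using (lev_succ_bounds c j).2
  · have h1 := ih k (by omega)
    have h2 := ih (k + 1) (by omega)
    by_cases h : c (j + k) = 1
    · rw [show j + (k + 1 + 1) = j + k + 2 by omega, lev_add_two_of_one h,
        lev_add_two_of_one (by exact h)]
      omega
    · rw [show j + (k + 1 + 1) = j + k + 2 by omega, lev_add_two_of_ne h,
        lev_add_two_of_ne (by exact h)]
      rw [← add_assoc] at h2; omega

/-- The recursion for `lev` that removes the first term instead of the last one. -/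
theorem lev_add_two_head (c : ℕ → ℕ) (k : ℕ) : lev c (k + 2) =
    (if c 0 = 1 then lev (fun i => c (2 + i)) k else lev (fun i => c (1 + i)) (k + 1)) + 1 := by
  induction k using Nat.strong_induction_on with
  | _ k ih =>
  rcases k with _ | _ | k
  · simp [lev]
  · simp only [lev]
    split_ifs <;> simp_all [lev]
  · have h1 := ih k (by omega)
    have h2 := ih (k + 1) (by omega)
    have e1 : 1 + (k + 1) = k + 2 := by omega
    have e2 : 2 + k = k + 2 := by omega
    rw [show k + 1 + 2 = k + 2 + 1 by omega] at h2
    by_cases h : c (k + 2) = 1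
    · rw [lev_add_two_of_one h, h1,
        lev_add_two_of_one (c := fun i => c (2 + i)) (by simpa [e2] using h),
        show k + 1 + 1 + 1 = k + 1 + 2 by omega,
        lev_add_two_of_one (c := fun i => c (1 + i)) (k := k + 1) (by simpa [e1] using h)]
      split_ifs <;> rfl
    · rw [lev_add_two_of_ne h, h2,
        lev_add_two_of_ne (c := fun i => c (2 + i)) (by simpa [e2] using h),
        show k + 1 + 1 + 1 = k + 1 + 2 by omega,
        lev_add_two_of_ne (c := fun i => c (1 + i)) (k := k + 1) (by simpa [e1] using h)]
      split_ifs <;> rfl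

/-- Two consecutive indices have the same level if and only if a step of length two leads to the
second one and the two indices before it have different levels. -/
theorem lev_succ_eq_iff (c : ℕ → ℕ) (j : ℕ) :
    lev c (j + 2) = lev c (j + 1) ↔ c j = 1 ∧ lev c (j + 1) ≠ lev c j := by
  have := lev_succ_bounds c j
  by_cases h : c j = 1
  · rw [lev_add_two_of_one h]; omega
  · rw [lev_add_two_of_ne h]; omega

/-- The index `j` lies on a shortest path from `0` to `N`. -/
def OnGeodesic (c : ℕ → ℕ) (N j : ℕ) : Prop :=
  j ≤ N ∧ lev c j + lev (fun i => c (j + i)) (N - j) = lev c N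

/-- A shortest path that visits `j < N` can be continued by a step of length one to an index of the
next level, or by a step of length two, for which `c j = 1`. -/
theorem OnGeodesic.step {c : ℕ → ℕ} {N j : ℕ} (h : OnGeodesic c N j) (hj : j < N) :
    (OnGeodesic c N (j + 1) ∧ lev c (j + 1) = lev c j + 1) ∨
      (c j = 1 ∧ OnGeodesic c N (j + 2)) := by
  obtain ⟨k, rfl⟩ : ∃ k, N = j + (k + 1) := ⟨N - j - 1, by omega⟩
  obtain ⟨-, h⟩ := h
  rw [Nat.add_sub_cancel_left] at h
  rcases k with _ | k
  · refine Or.inl ⟨⟨le_rfl, by simp [lev]⟩, ?_⟩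
    simpa [lev] using h.symm
  · rw [lev_add_two_head] at h
    have t1 := lev_add_le c (j + 1) (k + 1)
    have b1 := lev_succ_bounds c j
    simp only [add_zero, ← add_assoc] at h
    by_cases hc : c j = 1
    · refine Or.inr ⟨hc, by omega, ?_⟩
      rw [if_pos hc] at h
      rw [show j + (k + 1 + 1) - (j + 2) = k by omega, lev_add_two_of_one hc,
        show j + (k + 1 + 1) = j + k + 1 + 1 by omega, ← h]
      omega
    · rw [if_neg hc] at h
      rw [show j + 1 + (k + 1) = j + k + 1 + 1 by omega] at t1
      have : lev c (j + 1) = lev c j + 1 := by omega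
      refine Or.inl ⟨⟨by omega, ?_⟩, this⟩
      rw [show j + (k + 1 + 1) - (j + 1) = k + 1 by omega,
        show j + (k + 1 + 1) = j + k + 1 + 1 by omega, ← h]
      omega

/-- Of two consecutive indices, at least one lies on a shortest path. -/
theorem onGeodesic_or_succ (c : ℕ → ℕ) {N j : ℕ} (hj : j < N) :
    OnGeodesic c N j ∨ OnGeodesic c N (j + 1) := by
  induction j with
  | zero => exact Or.inl ⟨Nat.zero_le _, by simp [lev]⟩
  | succ j ih =>
    rcases ih (by omega) with h | h
    · rcases h.step (by omega) with h | h
      · exact Or.inl h.1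
      · exact Or.inr h.2
    · exact Or.inl h

/-- A shortest path from `0` to `N` visits `i` and `i + 3`, and one may choose which of `i + 1`
and `i + 2` it visits in between. -/
def IsSplit (c : ℕ → ℕ) (N i : ℕ) : Prop :=
  c i = 1 ∧ c (i + 1) = 1 ∧ lev c (i + 2) = lev c (i + 1) ∧ OnGeodesic c N (i + 3)

/-- A maximal run of ones in `c 0, …, c (n + 1)` ends at `q`, and it is of even length. The latter
is expressed by the levels after the run, see `exists_evenRunEnd_iff`. -/
def EvenRunEnd (c : ℕ → ℕ) (n q : ℕ) : Prop :=
  q ≤ n + 1 ∧ c q = 1 ∧ (q = n + 1 ∨ c (q + 1) ≠ 1) ∧ lev c (q + 2) ≠ lev c (q + 1)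

theorem EvenRunEnd.exists_split {c : ℕ → ℕ} {n q : ℕ} (h : EvenRunEnd c n q) :
    ∃ i ≤ n, IsSplit c (n + 3) i := by
  obtain ⟨hq, hc, hend, hlev⟩ := h
  have htwin : lev c (q + 1) = lev c q := by
    by_contra h
    exact hlev ((lev_succ_eq_iff c q).2 ⟨hc, h⟩)
  obtain ⟨i, rfl⟩ : ∃ i, q = i + 1 := by
    rcases q with _ | q
    · simp [lev] at htwin
    · exact ⟨q, rfl⟩
  refine ⟨i, by omega, ((lev_succ_eq_iff c i).1 htwin).1, hc, htwin, ?_⟩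
  rcases hend with h | h
  · obtain rfl : i = n := by omega
    exact ⟨le_rfl, by simp [lev]⟩
  · -- no step of length two starts at the index after the run
    rcases Nat.eq_or_lt_of_le (show i + 3 ≤ n + 3 by omega) with e | e
    · rw [e]; exact ⟨le_rfl, by simp [lev]⟩
    · rcases onGeodesic_or_succ c (N := n + 3) (j := i + 2) (by omega) with h' | h'
      · rcases h'.step (by omega) with h' | h'
        · exact h'.1
        · exact absurd h'.1 h
      · exact h'

/-- If a shortest path visits the first one of two indices of the same level, then a step of length
one from there would be wasted. So it goes on by steps of length two until the run of ones is used
up, and this happens at an index that shows the run to be of even length. -/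
theorem exists_evenRunEnd_of_lev_eq {c : ℕ → ℕ} {n j : ℕ} (hj : j ≤ n + 2)
    (hlev : lev c (j + 1) = lev c j) (hg : OnGeodesic c (n + 3) j) : ∃ q, EvenRunEnd c n q := by
  induction hd : n + 2 - j using Nat.strong_induction_on generalizing j with
  | _ d ih =>
  rcases hg.step (by omega) with h | ⟨hc, hg'⟩
  · omega
  · have hj2 : j ≤ n + 1 := by have := hg'.1; omega
    have hne : lev c (j + 2) ≠ lev c (j + 1) := by
      intro h
      exact ((lev_succ_eq_iff c j).1 h).2 hlev
    by_cases hend : j = n + 1 ∨ c (j + 1) ≠ 1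
    · exact ⟨j, hj2, hc, hend, hne⟩
    · push Not at hend
      exact ih (n + 2 - (j + 2)) (by omega) (by omega)
        ((lev_succ_eq_iff c (j + 1)).2 ⟨hend.2, hne⟩) hg' rfl

theorem IsSplit.exists_evenRunEnd {c : ℕ → ℕ} {n i : ℕ} (hi : i ≤ n) (h : IsSplit c (n + 3) i) :
    ∃ q, EvenRunEnd c n q := by
  obtain ⟨-, hc, hlev, hg⟩ := h
  have hne : lev c (i + 3) ≠ lev c (i + 2) := fun h =>
    ((lev_succ_eq_iff c (i + 1)).1 h).2 hlev
  by_cases hend : i + 1 = n + 1 ∨ c (i + 2) ≠ 1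
  · exact ⟨i + 1, by omega, hc, hend, hne⟩
  · push Not at hend
    exact exists_evenRunEnd_of_lev_eq (j := i + 3) (by omega)
      ((lev_succ_eq_iff c (i + 2)).2 ⟨hend.2, hne⟩) hg

/-- Within a run of ones, the levels increase at every other index. -/
theorem lev_succ_eq_iff_odd {c : ℕ → ℕ} {p : ℕ} (hp : p = 0 ∨ c (p - 1) ≠ 1) (d : ℕ)
    (h : ∀ i < d, c (p + i) = 1) : lev c (p + d + 1) = lev c (p + d) ↔ d % 2 = 1 := by
  induction d with
  | zero =>
    rcases p with _ | p
    · simp [lev]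
    · have := lev_succ_eq_iff c p
      simp at hp
      simp only [add_zero]
      rw [this]; simp [hp]
  | succ d ih =>
    have ih := ih fun i hi => h i (by omega)
    have h1 := h d (by omega)
    rw [show p + (d + 1) + 1 = p + d + 2 by omega, ← add_assoc, lev_succ_eq_iff, Ne, ih]
    simp only [h1, true_and]; omega

/-- There is a maximal run of ones of even length in `c 0, …, c (n + 1)`, extending from `p` to
`q`. -/
def EvenRun (c : ℕ → ℕ) (n p q : ℕ) : Prop :=
  p ≤ q ∧ q ≤ n + 1 ∧ (q - p) % 2 = 1 ∧ (∀ i, p ≤ i → i ≤ q → c i = 1) ∧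
    (p = 0 ∨ c (p - 1) ≠ 1) ∧ (q = n + 1 ∨ c (q + 1) ≠ 1)

theorem exists_run_start {c : ℕ → ℕ} {q : ℕ} (hq : c q = 1) :
    ∃ p ≤ q, (∀ i, p ≤ i → i ≤ q → c i = 1) ∧ (p = 0 ∨ c (p - 1) ≠ 1) := by
  induction q with
  | zero => exact ⟨0, le_rfl, fun i _ hi => by rwa [Nat.le_zero.1 hi], Or.inl rfl⟩
  | succ q ih =>
    by_cases h : c q = 1
    · obtain ⟨p, hp, h1, h2⟩ := ih h
      refine ⟨p, by omega, fun i hi hi' => ?_, h2⟩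
      rcases Nat.eq_or_lt_of_le hi' with rfl | hi'
      · exact hq
      · exact h1 i hi (by omega)
    · exact ⟨q + 1, le_rfl, fun i hi hi' => by rwa [le_antisymm hi' hi], Or.inr h⟩

theorem exists_evenRunEnd_iff (c : ℕ → ℕ) (n : ℕ) :
    (∃ q, EvenRunEnd c n q) ↔ ∃ p q, EvenRun c n p q := by
  constructor
  · rintro ⟨q, hq, hc, hend, hlev⟩
    obtain ⟨p, hp, h1, h2⟩ := exists_run_start hc
    have := lev_succ_eq_iff_odd h2 (q + 1 - p) fun i hi => h1 _ (by omega) (by omega)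
    rw [show p + (q + 1 - p) = q + 1 by omega] at this
    refine ⟨p, q, hp, hq, ?_, h1, h2, hend⟩
    by_contra h
    exact hlev (this.2 (by omega))
  · rintro ⟨p, q, hp, hq, hodd, h1, h2, hend⟩
    refine ⟨q, hq, h1 q hp le_rfl, hend, fun h => ?_⟩
    have := lev_succ_eq_iff_odd h2 (q + 1 - p) fun i hi => h1 _ (by omega) (by omega)
    rw [show p + (q + 1 - p) = q + 1 by omega] at this
    have := this.1 h
    omega

theorem exists_split_iff (c : ℕ → ℕ) (n : ℕ) :
    (∃ i ≤ n, IsSplit c (n + 3) i) ↔ ∃ p q, EvenRun c n p q := by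
  rw [← exists_evenRunEnd_iff]
  exact ⟨fun ⟨i, hi, h⟩ => h.exists_evenRunEnd hi, fun ⟨q, h⟩ => h.exists_split⟩

/-! ### Blocks of ones and runs of ones -/

theorem exists_run_end {s : ℕ → ℕ} {n k : ℕ} (hk : k ≤ n) (h : s k = 1) :
    ∃ j, k ≤ j ∧ j ≤ n ∧ (∀ i, k ≤ i → i ≤ j → s i = 1) ∧ (j < n → s (j + 1) ≠ 1) := by
  induction hd : n - k generalizing k with
  | zero =>
    exact ⟨k, le_rfl, hk, fun i hi hi' => by rwa [le_antisymm hi' hi], fun h => by omega⟩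
  | succ d ih =>
    by_cases h1 : s (k + 1) = 1
    · obtain ⟨j, hj, hn, hs, he⟩ := ih (k := k + 1) (by omega) h1 (by omega)
      refine ⟨j, by omega, hn, fun i hi hi' => ?_, he⟩
      rcases Nat.eq_or_lt_of_le hi with rfl | hi
      · exact h
      · exact hs i hi hi'
    · exact ⟨k, le_rfl, hk, fun i hi hi' => by rwa [le_antisymm hi' hi], fun _ => h1⟩

theorem exists_block {s : ℕ → ℕ} {n k : ℕ} (hk : k ≤ n) (h : s k = 1) :
    ∃ i j, IsBlock s n i j ∧ i ≤ k ∧ k ≤ j := by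
  obtain ⟨i, hi, hs, he⟩ := exists_run_start h
  obtain ⟨j, hj, hn, hs', he'⟩ := exists_run_end hk h
  refine ⟨i, j, ⟨by omega, hn, fun m hm hm' => ?_, fun h0 => ?_, he'⟩, hi, hj⟩
  · rcases le_total m k with hmk | hmk
    · exact hs m hm hmk
    · exact hs' m hmk hm'
  · exact he.resolve_left h0.ne'

namespace IsBlock

variable {s : ℕ → ℕ} {n i j k m : ℕ}

theorem le_of_ones (h : IsBlock s n i j) (hk : k ≤ j) (hm : m ≤ n)
    (hs : ∀ t, k ≤ t → t ≤ m → s t = 1) : m ≤ j := by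
  obtain ⟨-, -, -, -, he⟩ := h
  by_contra! hlt
  exact he (by omega) (hs _ (by omega) (by omega))

theorem ge_of_ones (h : IsBlock s n i j) (hk : i ≤ k) (hs : ∀ t, m ≤ t → t ≤ k → s t = 1) :
    i ≤ m := by
  obtain ⟨-, -, -, he, -⟩ := h
  by_contra! hlt
  exact he (by omega) (hs _ (by omega) (by omega))

theorem lt_of_ne (h : IsBlock s n i j) (hk : k ≤ j) (hm : m < k) (hs : s m ≠ 1) : m < i := by
  by_contra! hlt
  exact hs (h.2.2.1 m hlt (by omega))

theorem gt_of_ne (h : IsBlock s n i j) (hk : i ≤ k) (hm : k < m) (hs : s m ≠ 1) : j < m := by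
  by_contra! hlt
  exact hs (h.2.2.1 m (by omega) hlt)

end IsBlock

/-- The sequence `c 0, …, c (r + l + 1)` is `b 0, a 1, b 1, a 2, …`, where `a 0, …, a (r + 1)` and
`b 0, …, b (l + 1)` begin and end with ones. -/
structure Interlaced (a b c : ℕ → ℕ) (r l : ℕ) : Prop where
  eq_or : r = l ∨ r = l + 1
  odd : ∀ k, 2 * k + 1 ≤ r + l + 1 → c (2 * k + 1) = a (k + 1)
  even : ∀ k, 2 * k ≤ r + l + 1 → c (2 * k) = b k
  a_zero : a 0 = 1
  a_last : a (r + 1) = 1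
  b_zero : b 0 = 1
  b_last : b (l + 1) = 1

namespace Interlaced

variable {a b c : ℕ → ℕ} {r l : ℕ}

theorem ones (H : Interlaced a b c r l) {p q : ℕ} (hq : q ≤ r + l + 1)
    (hA : ∀ k, p + 1 ≤ 2 * k → 2 * k ≤ q + 1 → a k = 1)
    (hB : ∀ k, p ≤ 2 * k → 2 * k ≤ q → b k = 1) : ∀ i, p ≤ i → i ≤ q → c i = 1 := by
  intro i hi hi'
  rcases Nat.even_or_odd' i with ⟨k, rfl | rfl⟩
  · rw [H.even k (by omega)]; exact hB k hi hi'
  · rw [H.odd k (by omega)]; exact hA (k + 1) (by omega) (by omega)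

theorem zero (H : Interlaced a b c r l) : c 0 = 1 := by
  rw [← H.b_zero]; exact H.even 0 (by omega)

theorem last (H : Interlaced a b c r l) : c (r + l + 1) = 1 := by
  rcases H.eq_or with rfl | rfl
  · rw [show r + r + 1 = 2 * r + 1 by omega, H.odd r (by omega), H.a_last]
  · rw [show l + 1 + l + 1 = 2 * (l + 1) by omega, H.even _ (by omega), H.b_last]

/-- The ends of the two blocks are found from the parities of the ends of the run: at an end inside
the sequence, the block that contains the extreme term of the run may extend further, and the other
block ends with the run; at an end of the sequence, both blocks extend to the boundary terms. -/
theorem exists_overlap (H : Interlaced a b c r l) (hall : ¬ ∀ i, 1 ≤ i → i ≤ r + l → c i = 1)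
    {p q : ℕ} (h : EvenRun c (r + l) p q) :
    ∃ l₁ l₂ r₁ r₂, IsBlock b (l + 1) l₁ l₂ ∧ IsBlock a (r + 1) r₁ r₂ ∧
      OverlapConfig r l l₁ l₂ r₁ r₂ := by
  have hrl := H.eq_or
  obtain ⟨hpq, hqn, hodd, hones, hstart, hend⟩ := h
  have hA : ∀ k, p + 1 ≤ 2 * k → 2 * k ≤ q + 1 → a k = 1 := by
    intro k h1 h2
    obtain ⟨k, rfl⟩ : ∃ m, k = m + 1 := ⟨k - 1, by omega⟩
    rw [← H.odd k (by omega)]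
    exact hones _ (by omega) (by omega)
  have hB : ∀ k, p ≤ 2 * k → 2 * k ≤ q → b k = 1 := by
    intro k h1 h2
    rw [← H.even k (by omega)]
    exact hones _ h1 h2
  rcases Nat.even_or_odd' p with ⟨s, rfl | rfl⟩
  · obtain ⟨t, rfl⟩ : ∃ t, q = 2 * t + 1 := ⟨q / 2, by omega⟩
    have hend' : r + l = 2 * t ∨ b (t + 1) ≠ 1 := by
      rcases hend with h | h
      · omega
      · by_cases h' : r + l = 2 * t
        · exact Or.inl h'
        · right
          rwa [show 2 * t + 1 + 1 = 2 * (t + 1) by omega, H.even _ (by omega)] at h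
    obtain ⟨l₁, l₂, hL, hl1, hl2⟩ := exists_block (s := b) (n := l + 1) (k := s) (by omega)
      (hB s (by omega) (by omega))
    obtain ⟨r₁, r₂, hR, hr1, hr2⟩ := exists_block (s := a) (n := r + 1) (k := s + 1) (by omega)
      (hA (s + 1) (by omega) (by omega))
    have hl3 : t ≤ l₂ := hL.le_of_ones hl2 (by omega) fun k _ _ => hB k (by omega) (by omega)
    have hr3 : t + 1 ≤ r₂ :=
      hR.le_of_ones hr2 (by omega) fun k _ _ => hA k (by omega) (by omega)
    have hL2 := hL.2.1
    have hR2 := hR.2.1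
    refine ⟨l₁, l₂, r₁, r₂, hL, hR, ?_⟩
    rcases Nat.eq_zero_or_pos s with rfl | hs
    · have hr0 : r₁ ≤ 0 := hR.ge_of_ones hr1 fun k _ hk => by
        rcases Nat.eq_zero_or_pos k with rfl | hk'
        · exact H.a_zero
        · exact hA k (by omega) (by omega)
      rcases hend' with h | h
      · exact absurd (fun i _ hi => hones i (by omega) (by omega)) hall
      · have := hL.gt_of_ne (k := t) (m := t + 1) (by omega) (by omega) h
        unfold OverlapConfig; omega
    · have hs' : a s ≠ 1 := by
        have h := hstart.resolve_left (by omega)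
        rwa [show 2 * s - 1 = 2 * (s - 1) + 1 by omega, H.odd _ (by omega),
          show s - 1 + 1 = s by omega] at h
      have := hR.lt_of_ne hr2 (by omega) hs'
      rcases hend' with h | h
      · have : l + 1 ≤ l₂ := hL.le_of_ones (k := t) (by omega) le_rfl fun k hk hk' => by
          rcases Nat.eq_or_lt_of_le hk' with rfl | hk'
          · exact H.b_last
          · exact hB k (by omega) (by omega)
        unfold OverlapConfig; omega
      · have := hL.gt_of_ne (k := t) (m := t + 1) (by omega) (by omega) h
        unfold OverlapConfig; omega
  · obtain ⟨v, rfl⟩ : ∃ v, q = 2 * v := ⟨q / 2, by omega⟩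
    have hs' : b s ≠ 1 := by
      have h := hstart.resolve_left (by omega)
      rwa [show 2 * s + 1 - 1 = 2 * s by omega, H.even _ (by omega)] at h
    obtain ⟨l₁, l₂, hL, hl1, hl2⟩ := exists_block (s := b) (n := l + 1) (k := s + 1) (by omega)
      (hB (s + 1) (by omega) (by omega))
    obtain ⟨r₁, r₂, hR, hr1, hr2⟩ := exists_block (s := a) (n := r + 1) (k := s + 1) (by omega)
      (hA (s + 1) (by omega) (by omega))
    have hl3 : v ≤ l₂ := hL.le_of_ones hl2 (by omega) fun k _ _ => hB k (by omega) (by omega)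
    have hr3 : v ≤ r₂ := hR.le_of_ones hr2 (by omega) fun k _ _ => hA k (by omega) (by omega)
    have hL2 := hL.2.1
    have hR2 := hR.2.1
    have := hL.lt_of_ne hl2 (by omega) hs'
    refine ⟨l₁, l₂, r₁, r₂, hL, hR, ?_⟩
    by_cases hv : 2 * v = r + l + 1
    · have : r + 1 ≤ r₂ := hR.le_of_ones (k := v) (by omega) le_rfl fun k hk hk' => by
        rcases Nat.eq_or_lt_of_le hk' with rfl | hk'
        · exact H.a_last
        · exact hA k (by omega) (by omega)
      unfold OverlapConfig; omega
    · have h := hend.resolve_left (by omega)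
      rw [H.odd _ (by omega)] at h
      have := hR.gt_of_ne (k := v) (m := v + 1) (by omega) (by omega) h
      unfold OverlapConfig; omega

theorem exists_evenRun (H : Interlaced a b c r l) (hall : ¬ ∀ i, 1 ≤ i → i ≤ r + l → c i = 1)
    {l₁ l₂ r₁ r₂ : ℕ} (hL : IsBlock b (l + 1) l₁ l₂) (hR : IsBlock a (r + 1) r₁ r₂)
    (hO : OverlapConfig r l l₁ l₂ r₁ r₂) : ∃ p q, EvenRun c (r + l) p q := by
  have hrl := H.eq_or
  obtain ⟨hl, hln, hB, hLs, hLe⟩ := hL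
  obtain ⟨hr, hrn, hA, hRs, hRe⟩ := hR
  have hLe' : l₂ < l + 1 → l₂ < l := fun h => by
    by_contra h'
    obtain rfl : l₂ = l := by omega
    exact hLe h H.b_last
  have hRe' : r₂ < r + 1 → r₂ < r := fun h => by
    by_contra h'
    obtain rfl : r₂ = r := by omega
    exact hRe h H.a_last
  have hRs' : 0 < r₁ → 2 ≤ r₁ := fun h => by
    by_contra h'
    obtain rfl : r₁ = 1 := by omega
    exact hRs h H.a_zero
  -- if both sequences consist of ones, then so does `c`
  have hnot : (∀ k ≤ r + 1, a k = 1) → (∀ k ≤ l + 1, b k = 1) → False := fun h1 h2 =>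
    hall fun i _ hi => H.ones (p := 0) (q := r + l + 1) le_rfl
      (fun k _ _ => h1 k (by omega)) (fun k _ _ => h2 k (by omega)) i (by omega) (by omega)
  rcases hO with h | h | h | h | h
  · refine ⟨2 * (r₁ - 1), 2 * l₂ + 1, by omega, by omega, by omega,
      H.ones (by omega) (fun k _ _ => hA k (by omega) (by omega))
      (fun k _ _ => hB k (by omega) (by omega)), Or.inr ?_, Or.inr ?_⟩
    · rw [show 2 * (r₁ - 1) - 1 = 2 * (r₁ - 2) + 1 by omega, H.odd _ (by omega),
        show r₁ - 2 + 1 = r₁ - 1 by omega]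
      exact hRs (by omega)
    · rw [show 2 * l₂ + 1 + 1 = 2 * (l₂ + 1) by omega, H.even _ (by omega)]
      exact hLe (by omega)
  · refine ⟨2 * (r₁ - 1), 2 * r + 1, by omega, by omega, by omega,
      H.ones (by omega) (fun k _ _ => hA k (by omega) (by omega))
      (fun k _ _ => hB k (by omega) (by omega)), Or.inr ?_, Or.inl (by omega)⟩
    rw [show 2 * (r₁ - 1) - 1 = 2 * (r₁ - 2) + 1 by omega, H.odd _ (by omega),
      show r₁ - 2 + 1 = r₁ - 1 by omega]
    exact hRs (by omega)
  · by_cases hlt : l₂ < l + 1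
    · refine ⟨0, 2 * l₂ + 1, by omega, by omega, by omega,
        H.ones (by omega) (fun k _ _ => hA k (by omega) (by omega))
        (fun k _ _ => hB k (by omega) (by omega)), Or.inl rfl, Or.inr ?_⟩
      rw [show 2 * l₂ + 1 + 1 = 2 * (l₂ + 1) by omega, H.even _ (by omega)]
      exact hLe hlt
    · exact (hnot (fun k _ => hA k (by omega) (by omega))
        (fun k _ => hB k (by omega) (by omega))).elim
  · refine ⟨2 * (l₁ - 1) + 1, 2 * r₂, by omega, by omega, by omega,
      H.ones (by omega) (fun k _ _ => hA k (by omega) (by omega))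
      (fun k _ _ => hB k (by omega) (by omega)), Or.inr ?_, Or.inr ?_⟩
    · rw [Nat.add_sub_cancel, H.even _ (by omega)]
      exact hLs (by omega)
    · rw [H.odd _ (by omega)]
      exact hRe (by omega)
  · -- the block of `b` may end before `l + 1`; then the last block of `b` is used instead
    obtain ⟨m, hm, hm1, hms⟩ := exists_run_start H.b_last
    have hlm : l₁ ≤ m := by
      by_contra! hlt
      exact hLs (by omega) (hm1 _ (by omega) (by omega))
    rcases Nat.eq_zero_or_pos m with rfl | hpos
    · exact (hnot (fun k _ => hA k (by omega) (by omega))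
        (fun k hk => hm1 k (by omega) hk)).elim
    · refine ⟨2 * (m - 1) + 1, 2 * (l + 1), by omega, by omega, by omega,
        H.ones (by omega) (fun k _ _ => hA k (by omega) (by omega))
        (fun k _ _ => hm1 k (by omega) (by omega)), Or.inr ?_, Or.inl (by omega)⟩
      rw [Nat.add_sub_cancel, H.even _ (by omega)]
      exact hms.resolve_left hpos.ne'

/-- A maximal run of ones of even length in the sequence obtained by interlacing `a` and `b` amounts
to two overlapping blocks, unless there are only ones. -/
theorem exists_evenRun_iff (H : Interlaced a b c r l) :
    (∃ p q, EvenRun c (r + l) p q) ↔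
      ((∃ l₁ l₂ r₁ r₂, IsBlock b (l + 1) l₁ l₂ ∧ IsBlock a (r + 1) r₁ r₂ ∧
        OverlapConfig r l l₁ l₂ r₁ r₂) ∧ ¬ ∀ i, 1 ≤ i → i ≤ r + l → c i = 1) ∨
      (r = l ∧ ∀ i, 1 ≤ i → i ≤ r + l → c i = 1) := by
  have hrl := H.eq_or
  have hc0 := H.zero
  have hc1 := H.last
  constructor
  · rintro ⟨p, q, h⟩
    by_cases hall : ∀ i, 1 ≤ i → i ≤ r + l → c i = 1
    · obtain ⟨hpq, hqn, hodd, hones, hstart, hend⟩ := h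
      have hp : p = 0 := by
        refine hstart.resolve_right (not_not.2 ?_)
        rcases Nat.eq_zero_or_pos (p - 1) with h | h
        · rw [h, hc0]
        · exact hall _ h (by omega)
      have hq : q = r + l + 1 := by
        by_contra hne
        refine hend.resolve_left hne ?_
        rcases Nat.eq_or_lt_of_le (show q + 1 ≤ r + l + 1 by omega) with h | h
        · rw [h, hc1]
        · exact hall _ (by omega) (by omega)
      exact Or.inr ⟨by omega, hall⟩
    · exact Or.inl ⟨H.exists_overlap hall h, hall⟩
  · rintro (⟨⟨l₁, l₂, r₁, r₂, hL, hR, hO⟩, hall⟩ | ⟨rfl, hall⟩)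
    · exact H.exists_evenRun hall hL hR hO
    · refine ⟨0, r + r + 1, Nat.zero_le _, le_rfl, by omega, fun i _ hi => ?_, Or.inl rfl,
        Or.inl rfl⟩
      rcases Nat.eq_zero_or_pos i with rfl | h0
      · exact hc0
      · rcases Nat.eq_or_lt_of_le hi with rfl | hi
        · exact hc1
        · exact hall i h0 (by omega)

end Interlaced

/-! ### Shortest paths along a strip -/

theorem SplitsAt.symm {x y u z z' w : PLine} (h : SplitsAt x y u z z' w) :
    SplitsAt x y u z' z w := by
  obtain ⟨hne, p, q, hp, hq, s, t, hps, hqs⟩ := h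
  exact ⟨hne.symm, q, p, hq, hp, s, t, hqs, hps⟩

namespace Strip

variable (S : Strip) {N : ℕ}

theorem lev_shift_le_length {j k : ℕ} (h : j ≤ k) (p : G.Walk (S.P j) (S.P k)) :
    lev (fun i => S.c (j + i)) (k - j) ≤ p.length := by
  obtain ⟨d, rfl⟩ := Nat.exists_eq_add_of_le h
  rw [Nat.add_sub_cancel_left]
  exact (S.shift j).lev_le_length (k := d) p

theorem exists_walk_shift {j k : ℕ} (h : j ≤ k) : ∃ p : G.Walk (S.P j) (S.P k),
    p.length = lev (fun i => S.c (j + i)) (k - j) ∧ ∀ z ∈ p.support, ∃ m ≤ k, z = S.P m := by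
  obtain ⟨d, rfl⟩ := Nat.exists_eq_add_of_le h
  rw [Nat.add_sub_cancel_left]
  obtain ⟨p, hp, hs⟩ := (S.shift j).exists_walk d
  refine ⟨p, hp, fun z hz => ?_⟩
  obtain ⟨m, hm, rfl⟩ := hs z hz
  exact ⟨j + m, by omega, rfl⟩

/-- If a shortest path visits the point `S.P j` at time `t`, then `j` has level `t` and lies on a
shortest path of indices. -/
theorem onGeodesic_of_getVert {p : G.Walk (S.P 0) (S.P N)} (hp : p.length = lev S.c N) {t j : ℕ}
    (ht : t ≤ p.length) (hj : j ≤ N) (h : p.getVert t = S.P j) :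
    lev S.c j = t ∧ OnGeodesic S.c N j := by
  have h1 := S.lev_le_length ((p.take t).copy rfl h)
  have h2 := S.lev_shift_le_length hj ((p.drop t).copy h rfl)
  have h3 := lev_add_le S.c j (N - j)
  rw [SimpleGraph.Walk.length_copy, SimpleGraph.Walk.take_length] at h1
  rw [SimpleGraph.Walk.length_copy, SimpleGraph.Walk.drop_length] at h2
  rw [Nat.add_sub_cancel' hj] at h3
  refine ⟨by omega, hj, by omega⟩

theorem ne_of_lt {i j : ℕ} (h : i < j) : S.P i ≠ S.P j := by
  intro e
  have h1 := S.lev_shift_le_length h.le (SimpleGraph.Walk.nil.copy rfl e)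
  obtain ⟨k, hk⟩ : ∃ k, j - i = k + 1 := ⟨j - i - 1, by omega⟩
  have h2 := lev_succ_pos (fun m => S.c (i + m)) k
  rw [SimpleGraph.Walk.length_copy, SimpleGraph.Walk.length_nil, hk] at h1
  omega

/-- At a split, the two choices are realised by shortest paths inside the strip. -/
theorem exists_walks_of_isSplit {i : ℕ} (hi : i + 3 ≤ N) (h : IsSplit S.c N i) :
    ∃ p q : G.Walk (S.P 0) (S.P N), IsShortest p ∧ IsShortest q ∧
      (∃ s t : List PLine, p.support = s ++ S.P i :: S.P (i + 1) :: S.P (i + 3) :: t ∧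
        q.support = s ++ S.P i :: S.P (i + 2) :: S.P (i + 3) :: t) ∧
      (∀ z ∈ p.support, ∃ m ≤ N, z = S.P m) ∧ ∀ z ∈ q.support, ∃ m ≤ N, z = S.P m := by
  obtain ⟨hc, hc', hlev, hg, hD⟩ := h
  obtain ⟨p₁, hp₁, hs₁⟩ := S.exists_walk i
  obtain ⟨p₂, hp₂, hs₂⟩ := S.exists_walk_shift hi
  have hN : lev S.c N = lev S.c i + 2 + p₂.length := by
    rw [hp₂, ← hD, lev_add_two_of_one (k := i + 1) hc', ← hlev, lev_add_two_of_one hc]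
  have e₁ : p₁.support = p₁.support.dropLast ++ [S.P i] := by
    conv_lhs => rw [← List.dropLast_append_getLast p₁.support_ne_nil]
    rw [SimpleGraph.Walk.getLast_support]
  have e₂ : p₂.support = S.P (i + 3) :: p₂.support.tail := p₂.cons_tail_support.symm
  have main : ∀ z m, z = S.P m → m ≤ N → ∀ (h1 : G.Adj (S.P i) z) (h2 : G.Adj z (S.P (i + 3))),
      ∃ p : G.Walk (S.P 0) (S.P N), IsShortest p ∧
        p.support = p₁.support.dropLast ++ S.P i :: z :: S.P (i + 3) :: p₂.support.tail ∧
        ∀ z ∈ p.support, ∃ m ≤ N, z = S.P m := by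
    intro z m hz hm h1 h2
    have hsupp : (p₁.append (.cons h1 (.cons h2 p₂))).support =
        p₁.support.dropLast ++ S.P i :: z :: S.P (i + 3) :: p₂.support.tail := by
      rw [SimpleGraph.Walk.support_append, SimpleGraph.Walk.support_cons,
        SimpleGraph.Walk.support_cons, List.tail_cons, ← e₂]
      conv_lhs => rw [e₁]
      rw [List.append_assoc]
      rfl
    refine ⟨_, ?_, hsupp, ?_⟩
    · rw [IsShortest, S.dist_eq_lev, hN]
      simp [hp₁]; omega
    · intro v hv
      rw [SimpleGraph.Walk.support_append, SimpleGraph.Walk.support_cons,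
        SimpleGraph.Walk.support_cons, List.tail_cons, List.mem_append, List.mem_cons] at hv
      rcases hv with hv | rfl | hv
      · obtain ⟨k, hk, rfl⟩ := hs₁ v hv
        exact ⟨k, by omega, rfl⟩
      · exact ⟨m, hm, hz⟩
      · exact hs₂ v hv
  obtain ⟨p, hp, hps, hpc⟩ := main _ (i + 1) rfl (by omega) (S.adj_succ i) (S.adj_add_two hc')
  obtain ⟨q, hq, hqs, hqc⟩ := main _ (i + 2) rfl (by omega) (S.adj_add_two hc) (S.adj_succ (i + 2))
  exact ⟨p, q, hp, hq, ⟨_, _, hps, hqs⟩, hpc, hqc⟩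

theorem splitsAt_iff {x y : PLine} (hx : S.P 0 = x) (hy : S.P N = y) {i : ℕ} (hi : i + 3 ≤ N)
    (hc : S.c i = 1) (hc' : S.c (i + 1) = 1) :
    SplitsAt x y (S.P i) (S.P (i + 1)) (S.P (i + 2)) (S.P (i + 3)) ↔ IsSplit S.c N i := by
  subst hx hy
  constructor
  · rintro ⟨-, p, q, hp, hq, s, t, hps, hqs⟩
    rw [IsShortest, S.dist_eq_lev] at hp hq
    have vert : ∀ {p : G.Walk (S.P 0) (S.P N)} {k : ℕ} {z : PLine},
        p.support[k]? = some z → k ≤ p.length ∧ p.getVert k = z := by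
      intro p k z h
      have hk : k ≤ p.length := by
        obtain ⟨h', -⟩ := List.getElem?_eq_some_iff.1 h
        rw [SimpleGraph.Walk.length_support] at h'
        omega
      exact ⟨hk, by simpa [← p.getVert_eq_support_getElem? hk] using h⟩
    have v1 := vert (p := p) (k := s.length + 1) (z := S.P (i + 1)) (by simp [hps])
    have v2 := vert (p := q) (k := s.length + 1) (z := S.P (i + 2)) (by simp [hqs])
    have v3 := vert (p := p) (k := s.length + 2) (z := S.P (i + 3)) (by simp [hps])
    have g1 := S.onGeodesic_of_getVert hp v1.1 (by omega) v1.2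
    have g2 := S.onGeodesic_of_getVert hq v2.1 (by omega) v2.2
    have g3 := S.onGeodesic_of_getVert hp v3.1 hi v3.2
    exact ⟨hc, hc', g2.1.trans g1.1.symm, g3.2⟩
  · intro h
    obtain ⟨p, q, hp, hq, ⟨s, t, hps, hqs⟩, -⟩ := S.exists_walks_of_isSplit hi h
    exact ⟨S.ne_of_lt (by omega), p, q, hp, hq, s, t, hps, hqs⟩

/-- Where two shortest paths inside the strip diverge, they go to two points of the same level,
hence to `i + 1` and `i + 2` if they come from `i`, and then the former has to go on to `i + 3`. -/
theorem exists_isSplit_of_getVert_lt {p q : G.Walk (S.P 0) (S.P N)} (hp : p.length = lev S.c N)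
    (hq : q.length = lev S.c N) (hpc : ∀ z ∈ p.support, ∃ m ≤ N, z = S.P m) {t i m m' : ℕ}
    (ht : t < p.length) (hi : i ≤ N) (hm : m < m') (hm' : m' ≤ N)
    (hpi : p.getVert t = S.P i) (hqi : q.getVert t = S.P i) (hpm : p.getVert (t + 1) = S.P m)
    (hqm : q.getVert (t + 1) = S.P m') : ∃ i, i + 3 ≤ N ∧ IsSplit S.c N i := by
  have g := S.onGeodesic_of_getVert hp ht.le hi hpi
  have gp := S.onGeodesic_of_getVert hp ht (by omega) hpm
  have gq := S.onGeodesic_of_getVert hq (by omega) hm' hqm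
  have him : i < m := by
    by_contra! h
    have := lev_mono S.c h
    omega
  obtain ⟨rfl, hc⟩ : m' = i + 2 ∧ S.c i = 1 := by
    have hadj := q.adj_getVert_succ (i := t) (by omega)
    rw [hqi, hqm] at hadj
    exact (S.of_adj (by omega) hadj).resolve_left (by omega)
  obtain rfl : m = i + 1 := by omega
  have ht2 : t + 1 < p.length := by
    by_contra! h
    have h1 : p.getVert (t + 1) = S.P N := p.getVert_of_length_le h
    rw [hpm] at h1
    exact S.ne_of_lt (by omega) h1
  obtain ⟨j, hj, hpj⟩ := hpc _ (p.getVert_mem_support (t + 2))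
  have gj := S.onGeodesic_of_getVert hp ht2 hj hpj
  have hj2 : i + 2 < j := by
    by_contra! h
    have := lev_mono S.c h
    omega
  have hadj := p.adj_getVert_succ ht2
  rw [hpm, hpj] at hadj
  obtain ⟨rfl, hc'⟩ := (S.of_adj (by omega) hadj).resolve_left (by omega)
  exact ⟨i, hj, hc, hc', gq.1.trans gp.1.symm, gj.2⟩

theorem exists_isSplit_of_ne {p q : G.Walk (S.P 0) (S.P N)} (hp : p.length = lev S.c N)
    (hq : q.length = lev S.c N) (hpc : ∀ z ∈ p.support, ∃ m ≤ N, z = S.P m)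
    (hqc : ∀ z ∈ q.support, ∃ m ≤ N, z = S.P m) (hne : p ≠ q) :
    ∃ i, i + 3 ≤ N ∧ IsSplit S.c N i := by
  classical
  have hex : ∃ t, t ≤ p.length ∧ p.getVert t ≠ q.getVert t := by
    by_contra! h
    exact hne (SimpleGraph.Walk.ext_getVert_le_length (hp.trans hq.symm) h)
  obtain ⟨ht, hdiff⟩ := Nat.find_spec hex
  have hmin := fun t => Nat.find_min hex (m := t)
  generalize Nat.find hex = t at *
  obtain ⟨t, rfl⟩ : ∃ k, t = k + 1 := by
    rcases t with _ | t
    · simp at hdiff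
    · exact ⟨t, rfl⟩
  have hsame : p.getVert t = q.getVert t := by
    by_contra h
    exact hmin t (by omega) ⟨by omega, h⟩
  obtain ⟨i, hi, hpi⟩ := hpc _ (p.getVert_mem_support t)
  obtain ⟨m, hm, hpm⟩ := hpc _ (p.getVert_mem_support (t + 1))
  obtain ⟨m', hm', hqm⟩ := hqc _ (q.getVert_mem_support (t + 1))
  rcases lt_trichotomy m m' with h | rfl | h
  · exact S.exists_isSplit_of_getVert_lt hp hq hpc (by omega) hi h hm' hpi (hsame ▸ hpi) hpm hqm
  · exact absurd (hpm.trans hqm.symm) hdiff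
  · exact S.exists_isSplit_of_getVert_lt hq hp hqc (by omega) hi h hm (hsame ▸ hpi) hpi hqm hpm

theorem two_paths_iff {x y : PLine} (hx : S.P 0 = x) (hy : S.P N = y) :
    (∃ p q : G.Walk x y, p ≠ q ∧ IsShortest p ∧ IsShortest q ∧
      (∀ u ∈ p.support, ∃ m ≤ N, u = S.P m) ∧ (∀ u ∈ q.support, ∃ m ≤ N, u = S.P m)) ↔
    ∃ i, i + 3 ≤ N ∧ IsSplit S.c N i := by
  subst hx hy
  constructor
  · rintro ⟨p, q, hne, hp, hq, hpc, hqc⟩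
    rw [IsShortest, S.dist_eq_lev] at hp hq
    exact S.exists_isSplit_of_ne hp hq hpc hqc hne
  · rintro ⟨i, hi, h⟩
    obtain ⟨p, q, hp, hq, ⟨s, t, hps, hqs⟩, hpc, hqc⟩ := S.exists_walks_of_isSplit hi h
    refine ⟨p, q, ?_, hp, hq, hpc, hqc⟩
    rintro rfl
    rw [hps] at hqs
    simp only [List.append_cancel_left_eq, List.cons.injEq] at hqs
    exact S.ne_of_lt (by omega) hqs.2.1

/-- The vectors determined by the first two and the sizes of the fans. -/
def vec (c : ℕ → ℕ) (A B : ℤ × ℤ) : ℕ → ℤ × ℤ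
  | 0 => A
  | 1 => B
  | k + 2 => vec c A B k + (c k : ℤ) • vec c A B (k + 1)

theorem isUnit_det_vec (c : ℕ → ℕ) {A B : ℤ × ℤ} (h : IsUnit (det A B)) (i : ℕ) :
    IsUnit (det (vec c A B i) (vec c A B (i + 1))) := by
  induction i with
  | zero => exact h
  | succ i ih =>
    have : det (vec c A B (i + 1)) (vec c A B (i + 1 + 1)) =
        - det (vec c A B i) (vec c A B (i + 1)) := by
      rw [vec]; simp [det]; ring
    rw [this]; exact ih.neg

/-- The strip with given first two vectors and given sizes of the fans. -/
def ofBasis (c : ℕ → ℕ) (hc : ∀ i, 0 < c i) (A B : ℤ × ℤ) (h : IsUnit (det A B)) : Strip where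
  c := c
  W := vec c A B
  P i := ⟨Submodule.span ℤ {vec c A B i}, _, _, isCoprime_of_det (isUnit_det_vec c h i), rfl⟩
  c_pos := hc
  unit := h
  W_add_two _ := rfl
  gen _ := rfl

end Strip

/-! ### The strip of the transition algorithm -/

namespace Transition

variable {x y : PLine} (T : Transition x y)

/-- The members of `c` with the boundary conventions at both ends, continued by ones. -/
def fan (i : ℕ) : ℕ := if i ≤ T.r + T.l + 1 then T.c i else 1

theorem fan_odd (k : ℕ) (hk : 2 * k + 1 ≤ T.r + T.l + 1) : T.fan (2 * k + 1) = T.a (k + 1) := by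
  rw [fan, if_pos hk, c, if_pos (by omega)]
  congr 1; omega

theorem fan_even (k : ℕ) (hk : 2 * k ≤ T.r + T.l + 1) : T.fan (2 * k) = T.b k := by
  rw [fan, if_pos hk, c, if_neg (by omega)]
  congr 1; omega

theorem interlaced : Interlaced T.a T.b T.fan T.r T.l :=
  ⟨T.r_eq, T.fan_odd, T.fan_even, T.a_zero, T.a_last, T.b_zero, T.b_last⟩

theorem fan_pos (i : ℕ) : 0 < T.fan i := by
  have hrl := T.r_eq
  by_cases hi : i ≤ T.r + T.l + 1
  · rcases Nat.even_or_odd' i with ⟨k, rfl | rfl⟩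
    · rw [T.fan_even k hi]
      rcases k with _ | k
      · rw [T.b_zero]; exact one_pos
      · rcases Nat.lt_or_ge k T.l with h | h
        · exact T.b_pos k h
        · rw [show k = T.l by omega, T.b_last]; exact one_pos
    · rw [T.fan_odd k hi]
      rcases Nat.lt_or_ge k T.r with h | h
      · exact T.a_pos k h
      · rw [show k = T.r by omega, T.a_last]; exact one_pos
  · rw [fan, if_neg hi]; exact one_pos

theorem allOnes_iff : T.AllOnes ↔ ∀ i, 1 ≤ i → i ≤ T.r + T.l → T.fan i = 1 := by
  refine forall_congr' fun i => imp_congr_right fun _ => imp_congr_right fun hi => ?_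
  rw [fan, if_pos (by omega)]

/-- The points `x, e 0, f 0, e 1, f 1, …, y` form the beginning of a strip. -/
def strip : Strip :=
  Strip.ofBasis T.fan T.fan_pos (-T.X) (T.E 0) (by
    have : det (-T.X) (T.E 0) = - det (T.E 0) (T.F 0) := by
      rw [← T.start]; simp [det]; ring
    rw [this]; exact T.basis.neg)

theorem W_eq (k : ℕ) : (k ≤ T.r → T.strip.W (2 * k + 1) = T.E k) ∧
    (k ≤ T.l → T.strip.W (2 * k + 2) = T.F k) := by
  have hrl := T.r_eq
  induction k with
  | zero =>
    refine ⟨fun _ => rfl, fun _ => ?_⟩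
    have h0 : T.fan 0 = 1 := by rw [T.interlaced.zero]
    have : T.strip.W 2 = -T.X + (T.fan 0 : ℤ) • T.E 0 := rfl
    rw [mul_zero, zero_add, this, h0, ← T.start]
    simp
  | succ k ih =>
    have hE : k + 1 ≤ T.r → T.strip.W (2 * (k + 1) + 1) = T.E (k + 1) := by
      intro hk
      have h1 := T.strip.W_add_two (2 * k + 1)
      rw [ih.1 (by omega), ih.2 (by omega)] at h1
      rw [show 2 * (k + 1) + 1 = 2 * k + 1 + 2 by ring, h1, T.E_succ k hk]
      change _ + (T.fan (2 * k + 1) : ℤ) • _ = _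
      rw [T.fan_odd k (by omega), natCast_zsmul]
    refine ⟨hE, fun hk => ?_⟩
    have h1 := T.strip.W_add_two (2 * k + 2)
    rw [ih.2 (by omega), show 2 * k + 2 + 1 = 2 * (k + 1) + 1 by ring, hE (by omega)] at h1
    rw [show 2 * (k + 1) + 2 = 2 * k + 2 + 2 by ring, h1, T.F_succ k hk]
    change _ + (T.fan (2 * (k + 1)) : ℤ) • _ = _
    rw [T.fan_even (k + 1) (by omega), natCast_zsmul]

theorem P_zero : T.strip.P 0 = x := Gen.eq (T.strip.gen 0) T.gen_x.neg

theorem P_last : T.strip.P (T.r + T.l + 3) = y := by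
  refine Gen.eq (T.strip.gen _) ?_
  have h1 := T.strip.W_add_two (T.r + T.l + 1)
  have h2 : T.strip.c (T.r + T.l + 1) = 1 := T.interlaced.last
  rw [h2, Nat.cast_one, one_smul] at h1
  have h3 : T.strip.W (T.r + T.l + 3) = T.Y := by
    rw [h1, ← T.finish]
    rcases T.r_eq with h | h
    · rw [show T.r + T.l + 1 = 2 * T.r + 1 by omega, (T.W_eq _).1 le_rfl,
        show 2 * T.r + 1 + 1 = 2 * T.l + 2 by omega, (T.W_eq _).2 le_rfl]
    · rw [show T.r + T.l + 1 = 2 * T.l + 2 by omega, (T.W_eq _).2 le_rfl,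
        show 2 * T.l + 2 + 1 = 2 * T.r + 1 by omega, (T.W_eq _).1 le_rfl, add_comm]
  rw [h3]; exact T.gen_y

theorem P_odd {k : ℕ} (hk : 2 * k + 1 ≤ T.r + T.l + 3) : T.strip.P (2 * k + 1) = T.e k := by
  have hrl := T.r_eq
  rcases Nat.lt_or_ge T.r k with h | h
  · rw [show k = T.r + 1 by omega, T.e_last,
      show 2 * (T.r + 1) + 1 = T.r + T.l + 3 by omega, T.P_last]
  · have := T.strip.gen (2 * k + 1)
    rw [(T.W_eq k).1 h] at this
    exact Gen.eq this (T.gen_e k h)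

theorem P_even {k : ℕ} (hk : 2 * k + 2 ≤ T.r + T.l + 3) : T.strip.P (2 * k + 2) = T.f k := by
  have hrl := T.r_eq
  rcases Nat.lt_or_ge T.l k with h | h
  · rw [show k = T.l + 1 by omega, T.f_last,
      show 2 * (T.l + 1) + 2 = T.r + T.l + 3 by omega, T.P_last]
  · have := T.strip.gen (2 * k + 2)
    rw [(T.W_eq k).2 h] at this
    exact Gen.eq this (T.gen_f k h)

theorem isCornerVertex_iff {u : PLine} :
    T.IsCornerVertex u ↔ ∃ m ≤ T.r + T.l + 3, u = T.strip.P m := by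
  have hrl := T.r_eq
  constructor
  · rintro (rfl | rfl | ⟨k, hk, rfl⟩ | ⟨k, hk, rfl⟩)
    · exact ⟨0, by omega, T.P_zero.symm⟩
    · exact ⟨_, le_rfl, T.P_last.symm⟩
    · exact ⟨2 * k + 1, by omega, (T.P_odd (by omega)).symm⟩
    · exact ⟨2 * k + 2, by omega, (T.P_even (by omega)).symm⟩
  · rintro ⟨m, hm, rfl⟩
    rcases Nat.eq_or_lt_of_le hm with rfl | hm
    · exact Or.inr (Or.inl T.P_last)
    rcases Nat.even_or_odd' m with ⟨k, rfl | rfl⟩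
    · rcases k with _ | k
      · exact Or.inl T.P_zero
      · exact Or.inr (Or.inr (Or.inr ⟨k, by omega, T.P_even (by omega)⟩))
    · exact Or.inr (Or.inr (Or.inl ⟨k, by omega, T.P_odd (by omega)⟩))

theorem twoCornerPaths_iff : T.TwoCornerPaths ↔
    ∃ i ≤ T.r + T.l, IsSplit T.fan (T.r + T.l + 3) i := by
  have := T.strip.two_paths_iff T.P_zero T.P_last
  simp only [TwoCornerPaths, isCornerVertex_iff]
  rw [this]
  exact exists_congr fun i => and_congr_left fun _ => by omega

theorem splitsByOne_iff : T.SplitsByOne ↔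
    ∃ i ≤ T.r + T.l, IsSplit T.fan (T.r + T.l + 3) i := by
  have hrl := T.r_eq
  have key : ∀ i ≤ T.r + T.l, T.fan i = 1 → T.fan (i + 1) = 1 →
      (SplitsAt x y (T.strip.P i) (T.strip.P (i + 1)) (T.strip.P (i + 2)) (T.strip.P (i + 3)) ↔
        IsSplit T.fan (T.r + T.l + 3) i) := fun i hi h h' =>
    T.strip.splitsAt_iff T.P_zero T.P_last (by omega) h h'
  -- `u` in the second kind of quadrangle
  have hu : ∀ k ≤ T.l, (if k = 0 then x else T.f (k - 1)) = T.strip.P (2 * k) := by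
    intro k hk
    rcases k with _ | k
    · exact T.P_zero.symm
    · exact (T.P_even (by omega)).symm
  constructor
  · rintro (⟨k, h1, hk, ha, hb, h⟩ | ⟨k, hk, hb, ha, h⟩)
    · obtain ⟨k, rfl⟩ : ∃ m, k = m + 1 := ⟨k - 1, by omega⟩
      rw [Nat.add_sub_cancel, ← T.P_odd (by omega), ← T.P_odd (k := k + 1) (by omega),
        ← T.P_even (by omega), ← T.P_even (k := k + 1) (by omega)] at h
      exact ⟨2 * k + 1, by omega, (key _ (by omega) (by rwa [T.fan_odd k (by omega)])
        (by rw [← T.fan_even (k + 1) (by omega)] at hb; exact hb)).1 h⟩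
    · rw [hu k hk, ← T.P_odd (by omega), ← T.P_odd (k := k + 1) (by omega),
        ← T.P_even (by omega)] at h
      exact ⟨2 * k, by omega, (key _ (by omega) (by rwa [T.fan_even k (by omega)])
        (by rwa [T.fan_odd k (by omega)])).1 h.symm⟩
  · rintro ⟨i, hi, h⟩
    have hs := (key i hi h.1 h.2.1).2 h
    rcases Nat.even_or_odd' i with ⟨k, rfl | rfl⟩
    · refine Or.inr ⟨k, by omega, ?_, ?_, ?_⟩
      · rw [← T.fan_even k (by omega)]; exact h.1
      · rw [← T.fan_odd k (by omega)]; exact h.2.1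
      · rw [hu k (by omega), ← T.P_odd (by omega), ← T.P_odd (k := k + 1) (by omega),
          ← T.P_even (by omega)]
        exact hs.symm
    · refine Or.inl ⟨k + 1, by omega, by omega, ?_, ?_, ?_⟩
      · rw [← T.fan_odd k (by omega)]; exact h.1
      · rw [← T.fan_even (k + 1) (by omega)]; exact h.2.1
      · rw [Nat.add_sub_cancel, ← T.P_odd (by omega), ← T.P_odd (k := k + 1) (by omega),
          ← T.P_even (by omega), ← T.P_even (k := k + 1) (by omega)]
        exact hs

theorem exists_isSplit_iff : (∃ i ≤ T.r + T.l, IsSplit T.fan (T.r + T.l + 3) i) ↔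
    (T.BlocksOverlap ∧ ¬ T.AllOnes) ∨ (T.r = T.l ∧ T.AllOnes) := by
  rw [exists_split_iff, T.interlaced.exists_evenRun_iff, T.allOnes_iff]
  rfl

end Transition
end DistantGraph

theorem lemma5 (x y : DistantGraph.PLine) (hxy : x ≠ y) (hadj : ¬ DistantGraph.G.Adj x y)
    (T : DistantGraph.Transition x y) :
    (T.SplitsByOne ↔
      (T.BlocksOverlap ∧ ¬ T.AllOnes) ∨ (T.r = T.l ∧ T.AllOnes)) ∧
    (T.TwoCornerPaths ↔
      (T.BlocksOverlap ∧ ¬ T.AllOnes) ∨ (T.r = T.l ∧ T.AllOnes)) :=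
  ⟨T.splitsByOne_iff.trans T.exists_isSplit_iff, T.twoCornerPaths_iff.trans T.exists_isSplit_iff⟩
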